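/- Let $k=\overline{\mathbb{Q}}$. For a (not necessarily commutative) ring $R$, let $\mathrm{Spec}(R)$ be the set of prime two-sided ideals of $R$, ordered by inclusion and equipped with the Zariski topology, whose closed sets are the sets $\{P : P\supseteq I\}$ for two-sided ideals $I$ of $R$. For a left noetherian $k$-algebra $R$, a prime $P\in\mathrm{Spec}(R)$ is called locally closed if $\{P\}$ is a locally closed subset of $\mathrm{Spec}(R)$; primitive if it is the annihilator of a simple left $R$-module; and rational if the centre of the Goldie ring of quotients $Q(R/P)$ is algebraic over $k$. The algebra $R$ satisfies the Dixmier–Moeglin equivalence if for every $P\in\mathrm{Spec}(R)$ these three properties are equivalent. Let $A=k[x^{\pm1},y^{\pm1},u^{\pm1}]$, let $\sigma$ be the $k$-algebra automorphism of $A$ with $\sigma(x)=x^5y^4$, $\sigma(y)=xy$, $\sigma(u)=2u$, and let $S=A[z^{\pm1};\sigma]$ be the skew Laurent ring, in which $za=\sigma(a)z$ for $a\in A$. Then: 1. $S$ is a finitely generated, infinite-dimensional, prime, (left and right) noetherian $k$-algebra. 2. $\mathrm{Spec}(S)$ is homeomorphic to $\mathrm{Spec}(k[t])$. 3. The zero ideal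 of $S$ is rational but not locally closed; in particular $S$ does not satisfy the Dixmier–Moeglin equivalence. Consequently, over the countable field $k=\overline{\mathbb{Q}}$ the following assertions are all false: (a) If $R$ and $R'$ are left noetherian $k$-algebras and there is an inclusion-preserving bijection with inclusion-preserving inverse between the posets $\mathrm{Spec}(R)$ and $\mathrm{Spec}(R')$, then $R$ satisfies the Dixmier–Moeglin equivalence if and only if $R'$ does. (b) If $R$ and $R'$ are left noetherian $k$-algebras and $\mathrm{Spec}(R)$ and $\mathrm{Spec}(R')$ are homeomorphic, then $R$ satisfies the Dixmier–Moeglin equivalence if and only if $R'$ does. (c) If $R$ is a finitely generated left noetherian $k$-algebra such that $\mathrm{Spec}(R)$ is a finite disjoint union of locally closed subsets $X_1,\dots,X_d$, each homeomorphic, in the subspace topology, to the prime spectrum of a finitely generated commutative $k$-algebra, then $R$ satisfies the Dixmier–Moeglin equivalence. -/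

import Mathlib

universe u

noncomputable section

/-! ### Prime spectrum of a (not necessarily commutative) ring -/

/-- A two-sided ideal `P` of `R` is prime if it is proper and `a R b ⊆ P` implies
`a ∈ P` or `b ∈ P` (equivalently, `I J ⊆ P` implies `I ⊆ P` or `J ⊆ P` for two-sided ideals
`I`, `J`). In Mathlib `Ideal R` consists of left ideals, whence the first field. -/
structure IsPrimeTwoSided {R : Type*} [Ring R] (P : Ideal R) : Prop where
  isTwoSided : P.IsTwoSided
  ne_top : P ≠ ⊤
  mem_or_mem : ∀ a b : R, (∀ r : R, a * r * b ∈ P) → a ∈ P ∨ b ∈ P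

/-- A prime ring: the zero ideal is prime. -/
def IsPrimeRing (R : Type*) [Ring R] : Prop := IsPrimeTwoSided (⊥ : Ideal R)

/-- The set of prime two-sided ideals of a ring. -/
@[ext] structure NCSpec (R : Type*) [Ring R] where
  asIdeal : Ideal R
  isPrime : IsPrimeTwoSided asIdeal

namespace NCSpec

variable {R : Type*} [Ring R]

instance (P : NCSpec R) : P.asIdeal.IsTwoSided := P.isPrime.isTwoSided

/-- Primes are ordered by inclusion. -/
instance : PartialOrder (NCSpec R) :=
  PartialOrder.lift NCSpec.asIdeal (fun _ _ h => NCSpec.ext h)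

/-- The primes containing a given subset `s` of `R`, that is, containing the two-sided ideal
generated by `s`. -/
def zeroLocus (s : Set R) : Set (NCSpec R) := {P | s ⊆ P.asIdeal}

/-- The Zariski topology: the closed sets are the sets `zeroLocus s`. -/
instance : TopologicalSpace (NCSpec R) :=
  TopologicalSpace.ofClosed {Z | ∃ s : Set R, Z = zeroLocus s}
    ⟨Set.univ, by
      ext P
      simp only [zeroLocus, Set.mem_empty_iff_false, Set.mem_ofPred_eq, false_iff]
      exact fun h => P.isPrime.ne_top (Ideal.eq_top_iff_one _ |>.2 (h (Set.mem_univ _)))⟩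
    (by
      intro A hA
      refine ⟨⋃₀ {s | zeroLocus s ∈ A}, ?_⟩
      ext P
      simp only [zeroLocus, Set.mem_sInter, Set.mem_ofPred_eq, Set.sUnion_subset_iff]
      constructor
      · intro h s hs
        exact h _ hs
      · intro h Z hZ
        obtain ⟨s, rfl⟩ := hA hZ
        exact h s hZ)
    (by
      rintro _ ⟨s, rfl⟩ _ ⟨t, rfl⟩
      refine ⟨{x | ∃ a ∈ s, ∃ r : R, ∃ b ∈ t, x = a * r * b}, ?_⟩
      ext P
      simp only [zeroLocus, Set.mem_union, Set.mem_ofPred_eq]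
      constructor
      · rintro (h | h) _ ⟨a, ha, r, b, hb, rfl⟩
        · exact P.asIdeal.mul_mem_right _ (P.asIdeal.mul_mem_right _ (h ha))
        · exact P.asIdeal.mul_mem_left _ (h hb)
      · intro h
        by_contra! hc
        obtain ⟨a, ha, ha'⟩ := Set.not_subset.1 hc.1
        obtain ⟨b, hb, hb'⟩ := Set.not_subset.1 hc.2
        rcases P.isPrime.mem_or_mem a b (fun r => h ⟨a, ha, r, b, hb, rfl⟩) with h' | h'
        · exact ha' h'
        · exact hb' h')

/-- `P` is a locally closed point of the spectrum. -/
def LocallyClosed (P : NCSpec R) : Prop := IsLocallyClosed ({P} : Set (NCSpec R))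

/-- `P` is (left) primitive: the annihilator of a simple left `R`-module. (Every simple module is
isomorphic to a quotient of `R`, so modules in the universe of `R` suffice.) -/
def IsPrimitive {R : Type u} [Ring R] (P : NCSpec R) : Prop :=
  ∃ (M : Type u) (_ : AddCommGroup M) (_ : Module R M),
    IsSimpleModule R M ∧ Module.annihilator R M = P.asIdeal

/-- `P` is rational over `k`: the regular elements of `R ⧸ P` form a left Ore set (which is
automatic when `R` is left noetherian, by Goldie's theorem), and the centre of the Goldie quotient
ring `Q(R ⧸ P)`, the left Ore localization of `R ⧸ P` at its regular elements, is algebraic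
over `k`. -/
def IsRational (k : Type*) [Field k] {R : Type*} [Ring R] [Algebra k R] (P : NCSpec R) : Prop :=
  ∃ _ : OreLocalization.OreSet (nonZeroDivisors (R ⧸ P.asIdeal)),
    ∀ c ∈ Subalgebra.center k
      (OreLocalization (nonZeroDivisors (R ⧸ P.asIdeal)) (R ⧸ P.asIdeal)), IsAlgebraic k c

end NCSpec

/-- The Dixmier–Moeglin equivalence for a `k`-algebra `R`. -/
def DixmierMoeglin (k : Type*) [Field k] (R : Type*) [Ring R] [Algebra k R] : Prop :=
  ∀ P : NCSpec R, (P.LocallyClosed ↔ P.IsPrimitive) ∧ (P.IsPrimitive ↔ P.IsRational k)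

/-! ### Skew Laurent rings -/

/-- The skew Laurent ring `A[z^{±1}; σ]`: finite sums `∑ aₙ zⁿ` with `z a = σ(a) z`. It is the skew
monoid algebra of the infinite cyclic group acting on `A` through the powers of `σ`. -/
def SkewLaurent {k A : Type*} [CommSemiring k] [Ring A] [Algebra k A] (_σ : A ≃ₐ[k] A) : Type _ :=
  SkewMonoidAlgebra A (Multiplicative ℤ)

namespace SkewLaurent

variable {k A : Type*} [CommSemiring k] [Ring A] [Algebra k A] (σ : A ≃ₐ[k] A)

/-- The action of `ℤ` on `A` for which `n` acts as `σ ^ n`. -/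
@[reducible] def action : MulSemiringAction (Multiplicative ℤ) A :=
  MulSemiringAction.compHom A (zpowersHom (A ≃ₐ[k] A) σ)

theorem smulCommClass : letI := action σ; SMulCommClass (Multiplicative ℤ) k A :=
  letI := action σ
  ⟨fun n c a => map_smul (zpowersHom (A ≃ₐ[k] A) σ n) c a⟩

instance : Ring (SkewLaurent σ) :=
  letI := action σ
  (inferInstance : Ring (SkewMonoidAlgebra A (Multiplicative ℤ)))

instance : Algebra k (SkewLaurent σ) :=
  letI := action σ
  haveI := smulCommClass σ
  (inferInstance : Algebra k (SkewMonoidAlgebra A (Multiplicative ℤ)))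

/-- The monomial `a zⁿ`. -/
def monomial (n : ℤ) (a : A) : SkewLaurent σ :=
  SkewMonoidAlgebra.single (Multiplicative.ofAdd n) a

theorem monomial_mul_monomial (m n : ℤ) (a b : A) :
    monomial σ m a * monomial σ n b = monomial σ (m + n) (a * (σ ^ m) b) :=
  letI := action σ
  SkewMonoidAlgebra.single_mul_single

theorem algebraMap_apply (c : k) :
    algebraMap k (SkewLaurent σ) c = monomial σ 0 (algebraMap k A c) := rfl

end SkewLaurent

/-! ### The algebra `k[x^{±1}, y^{±1}, u^{±1}][z^{±1}; σ]` -/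

/-- The field `k` of algebraic numbers. -/
abbrev Qbar : Type := AlgebraicClosure ℚ

/-- The Laurent polynomial ring `k[x^{±1}, y^{±1}, u^{±1}]`, the group algebra of `ℤ³`; the basis
element at `(a, b, c)` is `x^a y^b u^c`. -/
abbrev Laurent3 : Type := AddMonoidAlgebra Qbar (ℤ × ℤ × ℤ)

/-- `x^a y^b u^c ↦ (x^5 y^4)^a (x y)^b (2 u)^c`. -/
def sigmaHom : Laurent3 →ₐ[Qbar] Laurent3 :=
  AddMonoidAlgebra.lift Qbar Laurent3 (ℤ × ℤ × ℤ)
    { toFun := fun v => AddMonoidAlgebra.single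
        (5 * v.toAdd.1 + v.toAdd.2.1, 4 * v.toAdd.1 + v.toAdd.2.1, v.toAdd.2.2)
        ((2 : Qbar) ^ v.toAdd.2.2)
      map_one' := by simp [AddMonoidAlgebra.one_def]; rfl
      map_mul' := fun v w => by
        rw [AddMonoidAlgebra.single_mul_single, toAdd_mul, Prod.snd_add, Prod.snd_add,
          zpow_add₀ two_ne_zero]
        congr 1
        ext <;> simp <;> ring }

/-- `x^a y^b u^c ↦ (x y^{-4})^a (x^{-1} y^5)^b (2^{-1} u)^c`. -/
def sigmaInvHom : Laurent3 →ₐ[Qbar] Laurent3 :=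
  AddMonoidAlgebra.lift Qbar Laurent3 (ℤ × ℤ × ℤ)
    { toFun := fun v => AddMonoidAlgebra.single
        (v.toAdd.1 - v.toAdd.2.1, -4 * v.toAdd.1 + 5 * v.toAdd.2.1, v.toAdd.2.2)
        ((2 : Qbar) ^ (-v.toAdd.2.2))
      map_one' := by simp [AddMonoidAlgebra.one_def]; rfl
      map_mul' := fun v w => by
        rw [AddMonoidAlgebra.single_mul_single, toAdd_mul, Prod.snd_add, Prod.snd_add, neg_add,
          zpow_add₀ two_ne_zero]
        congr 1
        ext <;> simp <;> ring }

theorem sigmaHom_single (a b c : ℤ) (r : Qbar) :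
    sigmaHom (AddMonoidAlgebra.single (a, b, c) r) =
      AddMonoidAlgebra.single (5 * a + b, 4 * a + b, c) (r * 2 ^ c) := by
  simp [sigmaHom, AddMonoidAlgebra.lift_single]

theorem sigmaInvHom_single (a b c : ℤ) (r : Qbar) :
    sigmaInvHom (AddMonoidAlgebra.single (a, b, c) r) =
      AddMonoidAlgebra.single (a - b, -4 * a + 5 * b, c) (r * 2 ^ (-c)) := by
  simp [sigmaInvHom, AddMonoidAlgebra.lift_single]

/-- The `k`-algebra automorphism `σ` of `k[x^{±1}, y^{±1}, u^{±1}]` with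
`σ(x) = x^5 y^4`, `σ(y) = x y`, `σ(u) = 2 u`. -/
def sigma : Laurent3 ≃ₐ[Qbar] Laurent3 :=
  AlgEquiv.ofAlgHom sigmaHom sigmaInvHom
    (by
      refine AlgHom.toLinearMap_injective (AddMonoidAlgebra.lhom_ext' fun v => LinearMap.ext_ring ?_)
      obtain ⟨a, b, c⟩ := v
      simp only [LinearMap.comp_apply, AddMonoidAlgebra.lsingle_apply, AlgHom.toLinearMap_apply,
        AlgHom.comp_apply, sigmaInvHom_single, sigmaHom_single, AlgHom.id_apply]
      congr 1
      · ext <;> simp <;> ring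
      · rw [one_mul, ← zpow_add₀ two_ne_zero]; simp)
    (by
      refine AlgHom.toLinearMap_injective (AddMonoidAlgebra.lhom_ext' fun v => LinearMap.ext_ring ?_)
      obtain ⟨a, b, c⟩ := v
      simp only [LinearMap.comp_apply, AddMonoidAlgebra.lsingle_apply, AlgHom.toLinearMap_apply,
        AlgHom.comp_apply, sigmaInvHom_single, sigmaHom_single, AlgHom.id_apply]
      congr 1
      · ext <;> simp <;> ring
      · rw [one_mul, ← zpow_add₀ two_ne_zero]; simp)

theorem sigma_x : sigma (AddMonoidAlgebra.single (1, 0, 0) 1) =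
    AddMonoidAlgebra.single (5, 4, 0) 1 :=
  (sigmaHom_single 1 0 0 1).trans (by norm_num)

theorem sigma_y : sigma (AddMonoidAlgebra.single (0, 1, 0) 1) =
    AddMonoidAlgebra.single (1, 1, 0) 1 :=
  (sigmaHom_single 0 1 0 1).trans (by norm_num)

theorem sigma_u : sigma (AddMonoidAlgebra.single (0, 0, 1) 1) =
    AddMonoidAlgebra.single (0, 0, 1) 2 :=
  (sigmaHom_single 0 0 1 1).trans (by norm_num)

/-- The skew Laurent ring `k[x^{±1}, y^{±1}, u^{±1}][z^{±1}; σ]`. -/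
abbrev SkewExample : Type := SkewLaurent sigma

end

/-!
Write `A` for the Laurent polynomial ring in `x`, `y`, `u`, and `S` for the skew Laurent ring.

*Ideals.* Conjugation by `u` multiplies `zⁿ` by `2⁻ⁿ`, and these scalars are distinct. Hence a
two-sided ideal of `S` is homogeneous in `z`, and it is generated by its intersection with `A`, a
`σ`-stable ideal (`SkewLaurent.mem_iff_coeff_mem_contract`). So the primes of `S` correspond to the
stable ideals of `A` that are prime with respect to stable ideals.

*Invariant fractions.* The matrix of `σ` on the exponents of `x` and `y` has the real eigenvalues
`3 ± 2√2`. An eigenvector gives an order on the exponents for which `σ` is monotone, and comparing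
leading terms shows that `σ` fixes no fraction of elements of `A` other than the constants
(`exists_smul_eq_of_mul_sigma_eq`). Therefore the centre of the division ring of `S` is `k`: a
central element acts as a bimodule homomorphism on a nonzero ideal, this ideal meets `A`, and
commutation with `u` and `z` produces an invariant fraction. So the zero ideal is rational
(`isRational_of_eq_bot`).

*Nonzero primes.* Let `I` be a nonzero stable ideal of `A`. It contains a nonzero `h` homogeneous
in `u` (`exists_uHomogeneous_mem`, by shortening relations through invariant fractions). Let `p` be
a prime above `I`. In a valuation of the fraction field of `A ⧸ p`, trivial on `k`, each relation
`σʲ(h) = 0` gives two monomials of equal value; the pigeonhole principle, for two values of `j`,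
makes all monomials in `x`, `y` have value `1`. So `x` and `y` are algebraic modulo `p`, hence
constants: `p` lies over a point of the torus `(k^×)²` (`exists_ker_torusEval_le`). Since `I` has
finitely many minimal primes, finitely many points occur. If `I` is prime with respect to stable
ideals, these facts make it the ideal of the finite orbit of a point, times the `u`-axis: a power of
`σ` that is trivial on the orbit scales the `u`-degrees by distinct factors modulo `I`
(`exists_eq_orbitIdeal`).

*The spectrum.* The nonzero primes of `S` thus are pairwise incomparable, and a nonzero element lies
in finitely many of them. There are infinitely many, as points with coordinates roots of unity have
finite orbits, and countably many, as `k` is countable. So the proper closed subsets of the spectrum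
are the finite sets of nonzero primes. The same holds for `k[t]`, and these data determine a space
up to homeomorphism (`nonempty_homeomorph_of_isClosed_iff`). In such a space the generic point is
not locally closed, so the Dixmier–Moeglin equivalence fails for `S`, while it holds for `k[t]`
(`dixmierMoeglin_polynomial`); the pair `S`, `k[t]` refutes the three assertions.
-/

noncomputable section

/-! ### Coefficients in a skew Laurent ring -/

namespace SkewLaurent

variable {k A : Type*} [CommSemiring k] [Ring A] [Algebra k A] {σ : A ≃ₐ[k] A}

/-- The coefficient of `zⁿ` in `f = ∑ aₙ zⁿ`, the coefficients being written on the left. -/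
def coeff (f : SkewLaurent σ) (n : ℤ) : A :=
  SkewMonoidAlgebra.coeff f (Multiplicative.ofAdd n)

/-- The finite set of exponents occurring in `f`. -/
def support (f : SkewLaurent σ) : Finset ℤ :=
  (SkewMonoidAlgebra.support f).map Multiplicative.toAdd.toEmbedding

theorem mem_support {f : SkewLaurent σ} {n : ℤ} : n ∈ f.support ↔ f.coeff n ≠ 0 := by
  simp only [support, coeff, Finset.mem_map_equiv]
  exact SkewMonoidAlgebra.mem_support_iff

@[ext] theorem ext {f g : SkewLaurent σ} (h : ∀ n, f.coeff n = g.coeff n) : f = g :=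
  SkewMonoidAlgebra.ext fun n => h n.toAdd

@[simp] theorem coeff_zero (n : ℤ) : (0 : SkewLaurent σ).coeff n = 0 := rfl

@[simp] theorem coeff_add (f g : SkewLaurent σ) (n : ℤ) :
    (f + g).coeff n = f.coeff n + g.coeff n :=
  DFunLike.congr_fun (SkewMonoidAlgebra.coeff_add (k := A) f g) _

@[simp] theorem coeff_smul (c : k) (f : SkewLaurent σ) (n : ℤ) :
    (c • f).coeff n = c • f.coeff n :=
  DFunLike.congr_fun (SkewMonoidAlgebra.coeff_smul (k := A) c f) _

theorem coeff_monomial (m n : ℤ) (a : A) :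
    (monomial σ m a).coeff n = if m = n then a else 0 := by
  classical
  exact (SkewMonoidAlgebra.coeff_single_apply (k := A)).trans (by simp)

variable (σ) in
/-- Taking the coefficient of `zⁿ`, as a linear map. -/
def lcoeff (n : ℤ) : SkewLaurent σ →ₗ[k] A where
  toFun f := f.coeff n
  map_add' _ _ := coeff_add _ _ _
  map_smul' _ _ := coeff_smul _ _ _

theorem coeff_sum {ι : Type*} (s : Finset ι) (f : ι → SkewLaurent σ) (n : ℤ) :
    (∑ i ∈ s, f i).coeff n = ∑ i ∈ s, (f i).coeff n :=
  map_sum (lcoeff σ n) f s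

theorem coeff_monomial_mul (m n : ℤ) (a : A) (f : SkewLaurent σ) :
    (monomial σ m a * f).coeff n = a * (σ ^ m) (f.coeff (n - m)) := by
  let := action σ
  rw [sub_eq_neg_add]
  exact SkewMonoidAlgebra.coeff_single_mul a (Multiplicative.ofAdd m) f (Multiplicative.ofAdd n)

theorem coeff_mul_monomial (m n : ℤ) (a : A) (f : SkewLaurent σ) :
    (f * monomial σ m a).coeff n = f.coeff (n - m) * (σ ^ (n - m)) a := by
  let := action σ
  exact SkewMonoidAlgebra.coeff_mul_single f a (Multiplicative.ofAdd m) (Multiplicative.ofAdd n)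

theorem one_eq_monomial : (1 : SkewLaurent σ) = monomial σ 0 1 := rfl

-- The instance is kept folded, so that its projections unify with those of an abstract ring.
attribute [local irreducible] SkewLaurent.instRing

theorem sum_monomial (f : SkewLaurent σ) : ∑ n ∈ f.support, monomial σ n (f.coeff n) = f := by
  ext m
  rw [coeff_sum]
  simp only [coeff_monomial]
  rw [Finset.sum_ite_eq']
  split_ifs with h
  · rfl
  · exact (not_not.1 (mem_support.not.1 h)).symm

@[simp] theorem monomial_zero_right (n : ℤ) : monomial σ n 0 = 0 := by
  ext m; simp [coeff_monomial]

theorem monomial_add (n : ℤ) (a b : A) :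
    monomial σ n (a + b) = monomial σ n a + monomial σ n b := by
  ext m; simp only [coeff_monomial, coeff_add]; split_ifs <;> simp

theorem monomial_injective (n : ℤ) : Function.Injective (monomial σ n) := fun a b h => by
  simpa [coeff_monomial] using congrArg (fun f => coeff f n) h

theorem smul_monomial (c : k) (n : ℤ) (a : A) : c • monomial σ n a = monomial σ n (c • a) := by
  ext m; simp only [coeff_monomial, coeff_smul]; split_ifs <;> simp

variable (σ) in
/-- The inclusion of the coefficient ring, as constant Laurent polynomials. -/
def C : A →ₐ[k] SkewLaurent σ where
  toFun := monomial σ 0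
  map_one' := one_eq_monomial.symm
  map_mul' a b := by rw [monomial_mul_monomial]; simp
  map_zero' := monomial_zero_right 0
  map_add' := monomial_add 0
  commutes' _ := rfl

theorem C_apply (a : A) : C σ a = monomial σ 0 a := rfl

theorem coeff_C_mul (a : A) (f : SkewLaurent σ) (n : ℤ) :
    (C σ a * f).coeff n = a * f.coeff n := by
  rw [C_apply, coeff_monomial_mul]; simp

theorem coeff_mul_C (a : A) (f : SkewLaurent σ) (n : ℤ) :
    (f * C σ a).coeff n = f.coeff n * (σ ^ n) a := by
  rw [C_apply, coeff_mul_monomial]; simp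

theorem C_mul_monomial (a b : A) (n : ℤ) : C σ a * monomial σ n b = monomial σ n (a * b) := by
  rw [C_apply, monomial_mul_monomial]; simp

theorem monomial_mul_C (a b : A) (n : ℤ) :
    monomial σ n a * C σ b = monomial σ n (a * (σ ^ n) b) := by
  rw [C_apply, monomial_mul_monomial, add_zero]

theorem monomial_mul_C_mul_monomial_neg (n : ℤ) (a : A) :
    monomial σ n 1 * C σ a * monomial σ (-n) 1 = C σ ((σ ^ n) a) := by
  rw [monomial_mul_C, monomial_mul_monomial]; simp [C_apply]

/-- The highest coefficients multiply without interference. -/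
instance [NoZeroDivisors A] : NoZeroDivisors (SkewLaurent σ) where
  eq_zero_or_eq_zero_of_mul_eq_zero := by
    intro f g h
    by_contra! hfg
    have top : ∀ f : SkewLaurent σ, f ≠ 0 → ∃ n, f.coeff n ≠ 0 ∧ ∀ m, n < m → f.coeff m = 0 := by
      intro f hf
      have hs : f.support.Nonempty := by
        rw [Finset.nonempty_iff_ne_empty]
        intro he
        exact hf (by rw [← sum_monomial f, he, Finset.sum_empty])
      refine ⟨f.support.max' hs, mem_support.1 (f.support.max'_mem hs), fun m hm => ?_⟩
      by_contra hne
      exact absurd (f.support.le_max' m (mem_support.2 hne)) (not_le.2 hm)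
    obtain ⟨m, hm, hm'⟩ := top f hfg.1
    obtain ⟨n, hn, hn'⟩ := top g hfg.2
    have key : (f * g).coeff (m + n) = f.coeff m * (σ ^ m) (g.coeff n) := by
      conv_lhs => rw [← sum_monomial f, Finset.sum_mul, coeff_sum]
      rw [Finset.sum_eq_single m]
      · rw [coeff_monomial_mul, add_sub_cancel_left]
      · intro i _ hi
        rw [coeff_monomial_mul]
        rcases lt_or_gt_of_ne hi with hi | hi
        · rw [hn' _ (by omega)]; simp
        · rw [hm' i hi, zero_mul]
      · intro h
        rw [coeff_monomial_mul, not_not.1 (mem_support.not.1 h), zero_mul]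
    rw [h, coeff_zero] at key
    rcases mul_eq_zero.1 key.symm with h | h
    · exact hm h
    · exact hn (by simpa using h)

instance [Nontrivial A] : Nontrivial (SkewLaurent σ) :=
  ⟨⟨0, 1, fun h => zero_ne_one (monomial_injective (σ := σ) 0
    ((monomial_zero_right 0).trans (h.trans one_eq_monomial)))⟩⟩

end SkewLaurent

/-! ### Noetherian property -/

section SkewHilbert

open Submodule

variable {A S : Type*} [CommRing A] [Ring S]

/-- The additive span of the `zⁱ a` with `i < n`: polynomials of degree less than `n` in `z`. -/
def degreeLTSpan (ι : A →+* S) (z : Sˣ) (n : ℕ) : AddSubgroup S :=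
  AddSubgroup.closure {s | ∃ i < n, ∃ a : A, s = (z : S) ^ i * ι a}

variable {ι : A →+* S} {z : Sˣ}

theorem mem_degreeLTSpan_succ {n : ℕ} {s : S} (hs : s ∈ degreeLTSpan ι z (n + 1)) :
    ∃ a : A, s - (z : S) ^ n * ι a ∈ degreeLTSpan ι z n := by
  induction hs using AddSubgroup.closure_induction with
  | mem s hs =>
    obtain ⟨i, hi, a, rfl⟩ := hs
    rcases Nat.lt_succ_iff_lt_or_eq.1 hi with hi | rfl
    · refine ⟨0, ?_⟩
      rw [map_zero, mul_zero, sub_zero]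
      exact AddSubgroup.subset_closure ⟨i, hi, a, rfl⟩
    · exact ⟨a, by simp [zero_mem]⟩
  | zero => exact ⟨0, by simp [zero_mem]⟩
  | add x y _ _ hx hy =>
    obtain ⟨a, ha⟩ := hx
    obtain ⟨b, hb⟩ := hy
    refine ⟨a + b, ?_⟩
    convert add_mem ha hb using 1
    rw [map_add, mul_add]; abel
  | neg x _ hx =>
    obtain ⟨a, ha⟩ := hx
    refine ⟨-a, ?_⟩
    convert neg_mem ha using 1
    rw [map_neg, mul_neg]; abel

theorem units_mul_mem_degreeLTSpan {n : ℕ} {s : S} (hs : s ∈ degreeLTSpan ι z n) :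
    (z : S) * s ∈ degreeLTSpan ι z (n + 1) := by
  induction hs using AddSubgroup.closure_induction with
  | mem s hs =>
    obtain ⟨i, hi, a, rfl⟩ := hs
    exact AddSubgroup.subset_closure ⟨i + 1, by omega, a, by rw [pow_succ', mul_assoc]⟩
  | zero => simp [zero_mem]
  | add x y _ _ hx hy => rw [mul_add]; exact add_mem hx hy
  | neg x _ hx => rw [mul_neg]; exact neg_mem hx

variable {τ : A ≃+* A} (hτ : ∀ a, (z : S) * ι a = ι (τ a) * z)
include hτ

theorem map_mul_pow_of_skew_comm (n : ℕ) (a : A) :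
    ι ((τ ^ n) a) * (z : S) ^ n = (z : S) ^ n * ι a := by
  induction n generalizing a with
  | zero => simp
  | succ n ih =>
    rw [pow_succ' (z : S), mul_assoc, ← ih, ← mul_assoc, ← mul_assoc, hτ, pow_succ' τ]; rfl

theorem map_mul_mem_degreeLTSpan {n : ℕ} {s : S} (hs : s ∈ degreeLTSpan ι z n) (b : A) :
    ι b * s ∈ degreeLTSpan ι z n := by
  induction hs using AddSubgroup.closure_induction with
  | mem s hs =>
    obtain ⟨i, hi, a, rfl⟩ := hs
    refine AddSubgroup.subset_closure ⟨i, hi, (τ ^ i).symm b * a, ?_⟩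
    rw [map_mul, ← mul_assoc, ← mul_assoc, ← map_mul_pow_of_skew_comm hτ, RingEquiv.apply_symm_apply]
  | zero => simp [zero_mem]
  | add x y _ _ hx hy => rw [mul_add]; exact add_mem hx hy
  | neg x _ hx => rw [mul_neg]; exact neg_mem hx

/-- The ideal of leading coefficients, in degree `n`, of the polynomials in `z` belonging to the
left ideal `I`. The coefficients are taken on the right of `zⁿ`, which makes these ideals grow
with `n`. -/
def leadingIdeal (I : Ideal S) (n : ℕ) : Ideal A where
  carrier := {a | ∃ f ∈ I, f - (z : S) ^ n * ι a ∈ degreeLTSpan ι z n}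
  add_mem' := by
    rintro a b ⟨f, hf, hfa⟩ ⟨g, hg, hgb⟩
    refine ⟨f + g, I.add_mem hf hg, ?_⟩
    convert add_mem hfa hgb using 1
    rw [map_add, mul_add]; abel
  zero_mem' := ⟨0, I.zero_mem, by simp [zero_mem]⟩
  smul_mem' := by
    rintro b a ⟨f, hf, hfa⟩
    refine ⟨ι ((τ ^ n) b) * f, I.mul_mem_left _ hf, ?_⟩
    convert map_mul_mem_degreeLTSpan hτ hfa ((τ ^ n) b) using 1
    rw [mul_sub, smul_eq_mul, map_mul, ← mul_assoc, ← mul_assoc, map_mul_pow_of_skew_comm hτ]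

theorem leadingIdeal_mono {I J : Ideal S} (h : I ≤ J) {m n : ℕ} (hmn : m ≤ n) :
    leadingIdeal hτ I m ≤ leadingIdeal hτ J n := by
  have : Monotone (leadingIdeal hτ J) := monotone_nat_of_le_succ (by
    rintro n a ⟨f, hf, hfa⟩
    refine ⟨(z : S) * f, J.mul_mem_left _ hf, ?_⟩
    rw [pow_succ', mul_assoc, ← mul_sub]
    exact units_mul_mem_degreeLTSpan hfa)
  refine le_trans ?_ (this hmn)
  rintro a ⟨f, hf, hfa⟩
  exact ⟨f, h hf, hfa⟩

theorem eq_of_leadingIdeal_eq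
    (hspan : ∀ s : S, ∃ m n : ℕ, (z : S) ^ m * s ∈ degreeLTSpan ι z n)
    {I J : Ideal S} (h : I ≤ J) (he : ∀ n, leadingIdeal hτ J n ≤ leadingIdeal hτ I n) : I = J := by
  have key : ∀ n, ∀ f ∈ J, f ∈ degreeLTSpan ι z n → f ∈ I := by
    intro n
    induction n with
    | zero =>
      intro f _ hf
      have : degreeLTSpan ι z 0 = ⊥ := by simp [degreeLTSpan]
      rw [this, AddSubgroup.mem_bot] at hf
      exact hf ▸ I.zero_mem
    | succ n ih =>
      intro f hfJ hf
      obtain ⟨a, ha⟩ := mem_degreeLTSpan_succ hf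
      obtain ⟨g, hg, hga⟩ := he n ⟨f, hfJ, ha⟩
      have := ih (f - g) (J.sub_mem hfJ (h hg)) (by
        convert sub_mem ha hga using 1; abel)
      simpa using I.add_mem this hg
  refine le_antisymm h fun s hs => ?_
  obtain ⟨m, n, hmn⟩ := hspan s
  have := I.mul_mem_left ((z⁻¹ ^ m : Sˣ) : S) (key n _ (J.mul_mem_left _ hs) hmn)
  rwa [← mul_assoc, ← Units.val_pow_eq_pow_val, ← Units.val_mul, inv_pow, inv_mul_cancel,
    Units.val_one, one_mul] at this

/-- Hilbert's basis theorem for skew Laurent extensions: if `S` is spanned by the `zⁿ a` with `z` a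
unit normalizing the image of the commutative noetherian ring `A`, then `S` is left noetherian. -/
theorem isNoetherianRing_of_skew_laurent [IsNoetherianRing A]
    (hspan : ∀ s : S, ∃ m n : ℕ, (z : S) ^ m * s ∈ degreeLTSpan ι z n) : IsNoetherianRing S := by
  rw [isNoetherianRing_iff, ← monotone_stabilizes_iff_noetherian]
  intro I
  -- The double sequence of leading ideals is stationary along the diagonal, from `N` on.
  obtain ⟨N, hN⟩ := monotone_stabilizes_iff_noetherian.2 ‹IsNoetherian A A›
    ⟨fun n => leadingIdeal hτ (I n) n, fun m n h => leadingIdeal_mono hτ (I.mono h) h⟩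
  -- Each of the finitely many rows of degree less than `N` is stationary as well.
  have hrow : ∀ d, ∃ M, ∀ m, M ≤ m → leadingIdeal hτ (I M) d = leadingIdeal hτ (I m) d := fun d =>
    monotone_stabilizes_iff_noetherian.2 ‹IsNoetherian A A›
      ⟨fun n => leadingIdeal hτ (I n) d, fun m n h => leadingIdeal_mono hτ (I.mono h) le_rfl⟩
  choose M hM using hrow
  refine ⟨N + ∑ d ∈ Finset.range N, M d, fun m hm => ?_⟩
  refine eq_of_leadingIdeal_eq hτ hspan (I.mono hm) fun d => ?_
  rcases lt_or_ge d N with hd | hd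
  · have h1 : M d ≤ ∑ d ∈ Finset.range N, M d :=
      Finset.single_le_sum (fun _ _ => Nat.zero_le _) (Finset.mem_range.2 hd)
    rw [← hM d m (by omega), hM d _ (h1.trans (Nat.le_add_left _ _))]
  · calc leadingIdeal hτ (I m) d ≤ leadingIdeal hτ (I (m + d)) (m + d) :=
          leadingIdeal_mono hτ (I.mono (by omega)) (by omega)
      _ = leadingIdeal hτ (I N) N := (hN (m + d) (by omega)).symm
      _ ≤ _ := leadingIdeal_mono hτ (I.mono (by omega)) hd

end SkewHilbert

namespace SkewLaurent

variable {k A : Type*} [CommSemiring k] [CommRing A] [Algebra k A] {σ : A ≃ₐ[k] A}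

variable (σ) in
/-- The unit `zⁿ`. -/
def zUnit (n : ℤ) : (SkewLaurent σ)ˣ where
  val := monomial σ n 1
  inv := monomial σ (-n) 1
  val_inv := by rw [monomial_mul_monomial]; simp [one_eq_monomial]
  inv_val := by rw [monomial_mul_monomial]; simp [one_eq_monomial]

theorem zUnit_pow (n : ℤ) (m : ℕ) : (zUnit σ n : SkewLaurent σ) ^ m = monomial σ (m * n) 1 := by
  induction m with
  | zero => simp [one_eq_monomial]
  | succ m ih =>
    rw [pow_succ, ih]
    change _ * monomial σ n 1 = _
    rw [monomial_mul_monomial]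
    simp [add_mul]

attribute [local irreducible] SkewLaurent.instRing

/-- A bound for the exponents of a Laurent polynomial. -/
theorem exists_support_bound (f : SkewLaurent σ) : ∃ N : ℕ, ∀ n ∈ f.support, |n| < N := by
  refine ⟨∑ n ∈ f.support, (n.natAbs + 1), fun n hn => ?_⟩
  have := Finset.single_le_sum (f := fun n : ℤ => n.natAbs + 1) (fun _ _ => Nat.zero_le _) hn
  rw [Int.abs_eq_natAbs]
  omega

instance isNoetherianRing [IsNoetherianRing A] : IsNoetherianRing (SkewLaurent σ) := by
  refine isNoetherianRing_of_skew_laurent (ι := (C σ).toRingHom) (z := zUnit σ 1)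
    (τ := σ.toRingEquiv) (fun a => ?_) (fun f => ?_)
  · change monomial σ 1 1 * monomial σ 0 a = monomial σ 0 (σ a) * monomial σ 1 1
    rw [monomial_mul_monomial, monomial_mul_monomial]; simp
  · obtain ⟨N, hN⟩ := exists_support_bound f
    refine ⟨N, 2 * N, ?_⟩
    rw [← sum_monomial f, Finset.mul_sum]
    refine sum_mem fun n hn => AddSubgroup.subset_closure ?_
    have := abs_lt.1 (hN n hn)
    refine ⟨(N + n).toNat, by omega, (σ ^ (-(N + n))) ((σ ^ (N : ℤ)) (f.coeff n)), ?_⟩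
    change _ = _ * monomial σ 0 _
    rw [zUnit_pow, zUnit_pow, monomial_mul_monomial, monomial_mul_monomial,
      Int.toNat_of_nonneg (by omega)]
    simp only [mul_one, one_mul, add_zero]
    rw [← AlgEquiv.mul_apply, ← zpow_add]
    simp

open MulOpposite in
instance isNoetherianRing_op [IsNoetherianRing A] : IsNoetherianRing (SkewLaurent σ)ᵐᵒᵖ := by
  have hι : ∀ x y : A, Commute (C σ x) (C σ y) := fun x y => by
    rw [Commute, SemiconjBy, ← map_mul, ← map_mul, mul_comm]
  refine isNoetherianRing_of_skew_laurent (ι := (C σ).toRingHom.toOpposite hι)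
    (z := (Units.opEquiv.symm (op (zUnit σ 1)))) (τ := σ.symm.toRingEquiv) (fun a => ?_)
    (fun f => ?_)
  · change op (monomial σ 1 1) * op (monomial σ 0 a) =
      op (monomial σ 0 (σ.symm a)) * op (monomial σ 1 1)
    rw [← op_mul, ← op_mul, monomial_mul_monomial, monomial_mul_monomial]; simp
  · obtain ⟨N, hN⟩ := exists_support_bound f.unop
    refine ⟨N, 2 * N, ?_⟩
    rw [← op_unop f, ← sum_monomial f.unop, Finset.op_sum, Finset.mul_sum]
    refine sum_mem fun n hn => AddSubgroup.subset_closure ?_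
    have := abs_lt.1 (hN n hn)
    refine ⟨(N + n).toNat, by omega, f.unop.coeff n, ?_⟩
    change op (zUnit σ 1 : SkewLaurent σ) ^ _ * _ =
      op (zUnit σ 1 : SkewLaurent σ) ^ _ * op (monomial σ 0 _)
    rw [← op_pow, ← op_pow, ← op_mul, ← op_mul, zUnit_pow, zUnit_pow, monomial_mul_monomial,
      monomial_mul_monomial, Int.toNat_of_nonneg (by omega)]
    simp [add_comm]

end SkewLaurent

end

noncomputable section

/-! ### Two-sided ideals of a skew Laurent ring -/

/-- If an operator `T` preserves a subspace `W`, and the `v i` are eigenvectors of `T` modulo `W`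
for distinct eigenvalues, then a sum of the `v i` lies in `W` only if each `v i` does. -/
theorem Submodule.mem_of_sum_mem_of_eigenvalues {k V ι : Type*} [Field k] [AddCommGroup V]
    [Module k V] (W : Submodule k V) (T : V →ₗ[k] V) (hT : ∀ w ∈ W, T w ∈ W) (s : Finset ι)
    (l : ι → k) (hl : Set.InjOn l s) (v : ι → V) (hv : ∀ i ∈ s, T (v i) - l i • v i ∈ W)
    (h : ∑ i ∈ s, v i ∈ W) : ∀ i ∈ s, v i ∈ W := by
  classical
  induction s using Finset.induction_on generalizing v with
  | empty => simp
  | insert a s ha ih =>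
    -- Applying `T - l a` removes the term of index `a` modulo `W`.
    have key : ∀ i ∈ s, (l i - l a) • v i ∈ W := by
      refine ih (hl.mono (by simp)) (fun i => (l i - l a) • v i) (fun i hi => ?_) ?_
      · have := W.smul_mem (l i - l a) (hv i (Finset.mem_insert_of_mem hi))
        rwa [smul_sub, ← map_smul, smul_comm] at this
      · have h1 := W.sub_mem (W.sub_mem (hT _ h) (W.smul_mem (l a) h))
          (W.sum_mem fun i hi => hv i hi)
        convert h1 using 1
        rw [map_sum, Finset.smul_sum, ← Finset.sum_sub_distrib, ← Finset.sum_sub_distrib,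
          Finset.sum_insert ha]
        rw [show T (v a) - l a • v a - (T (v a) - l a • v a) = 0 by abel, zero_add]
        exact Finset.sum_congr rfl fun i _ => by rw [sub_smul]; abel
    have hs : ∀ i ∈ s, v i ∈ W := fun i hi => by
      have hne : l i - l a ≠ 0 := sub_ne_zero.2 fun he =>
        ha (hl (by simp [hi]) (by simp) he ▸ hi)
      exact (W.smul_mem_iff hne).1 (key i hi)
    intro i hi
    rcases Finset.mem_insert.1 hi with rfl | hi
    · rw [Finset.sum_insert ha] at h
      exact (W.add_mem_iff_left (W.sum_mem hs)).1 h
    · exact hs i hi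

namespace SkewLaurent

variable {k A : Type*} [Field k] [CommRing A] [Algebra k A] {σ : A ≃ₐ[k] A}

attribute [local irreducible] SkewLaurent.instRing

variable (σ) in
/-- The automorphism `σ` has a unit eigenvector whose eigenvalue has infinite order. -/
def HasUnitEigenvector : Prop :=
  ∃ (u : Aˣ) (q : kˣ), (∀ n : ℤ, q ^ n = 1 → n = 0) ∧ ∀ n : ℤ, (σ ^ n) u = (q ^ n : kˣ) • (u : A)

/-- Conjugation by the eigenvector is diagonal on the powers of `z`, with distinct eigenvalues;
so a two-sided ideal contains the homogeneous components of its elements. -/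
theorem monomial_coeff_mem (hσ : HasUnitEigenvector σ) (P : Ideal (SkewLaurent σ)) [P.IsTwoSided]
    {f : SkewLaurent σ} (hf : f ∈ P) (n : ℤ) : monomial σ n (f.coeff n) ∈ P := by
  obtain ⟨u, q, hq, hu⟩ := hσ
  let T : SkewLaurent σ →ₗ[k] SkewLaurent σ :=
    LinearMap.mulRight k (C σ (u⁻¹ : Aˣ)) ∘ₗ LinearMap.mulLeft k (C σ u)
  have hT : ∀ f, T f = C σ u * f * C σ (u⁻¹ : Aˣ) := fun f => rfl
  have huinv : ∀ n : ℤ, (σ ^ n) (u⁻¹ : Aˣ) = (q ^ (-n) : kˣ) • ((u⁻¹ : Aˣ) : A) := fun n => by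
    have h1 : (σ ^ n) (u : A) * (σ ^ n) (u⁻¹ : Aˣ) = 1 := by rw [← map_mul]; simp
    rw [hu, smul_mul_assoc] at h1
    calc (σ ^ n) ((u⁻¹ : Aˣ) : A)
        = (q ^ (-n) : kˣ) • ((u⁻¹ : Aˣ) * ((q ^ n : kˣ) • (u * (σ ^ n) (u⁻¹ : Aˣ))) : A) := by
          rw [mul_smul_comm, smul_smul, ← zpow_add]; simp
      _ = _ := by rw [h1, mul_one]
  by_cases hn : n ∈ f.support
  · refine Submodule.mem_of_sum_mem_of_eigenvalues (P.restrictScalars k) T (fun w hw => ?_)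
      f.support (fun n => ((q ^ (-n) : kˣ) : k)) (fun m _ n _ h => ?_)
      (fun n => monomial σ n (f.coeff n)) (fun m _ => ?_) ?_ n hn
    · rw [hT]
      exact P.mul_mem_right _ (P.mul_mem_left _ hw)
    · have h : q ^ (-m) = q ^ (-n) := Units.ext h
      have := hq (-m - -n) (by rw [zpow_sub, h, mul_inv_cancel])
      omega
    · convert Submodule.zero_mem _
      rw [hT, C_mul_monomial, monomial_mul_C, huinv, sub_eq_zero, smul_monomial]
      congr 1
      rw [mul_smul_comm, mul_right_comm]
      simp [Units.smul_def]
    · rwa [sum_monomial]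
  · rw [not_not.1 (mem_support.not.1 hn), monomial_zero_right]
    exact P.zero_mem

/-- The intersection of an ideal with the coefficient ring. -/
def contract (P : Ideal (SkewLaurent σ)) : Ideal A := P.comap (C σ)

theorem mem_contract {P : Ideal (SkewLaurent σ)} {a : A} : a ∈ contract P ↔ C σ a ∈ P := Iff.rfl

theorem monomial_mem_iff {P : Ideal (SkewLaurent σ)} [P.IsTwoSided] (n : ℤ) (a : A) :
    monomial σ n a ∈ P ↔ a ∈ contract P := by
  rw [mem_contract, C_apply]
  constructor <;> intro h
  · have := P.mul_mem_right (monomial σ (-n) 1) h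
    rw [monomial_mul_monomial] at this
    simpa using this
  · have := P.mul_mem_right (monomial σ n 1) h
    rw [monomial_mul_monomial] at this
    simpa using this

theorem zpow_mem_contract {P : Ideal (SkewLaurent σ)} [P.IsTwoSided] {a : A}
    (ha : a ∈ contract P) (n : ℤ) : (σ ^ n) a ∈ contract P := by
  rw [mem_contract, ← monomial_mul_C_mul_monomial_neg]
  exact P.mul_mem_right _ (P.mul_mem_left _ ha)

theorem mem_iff_coeff_mem_contract (hσ : HasUnitEigenvector σ) {P : Ideal (SkewLaurent σ)}
    [P.IsTwoSided] {f : SkewLaurent σ} : f ∈ P ↔ ∀ n, f.coeff n ∈ contract P := by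
  refine ⟨fun h n => (monomial_mem_iff n _).1 (monomial_coeff_mem hσ P h n), fun h => ?_⟩
  rw [← sum_monomial f]
  exact P.sum_mem fun n _ => (monomial_mem_iff n _).2 (h n)

theorem eq_of_contract_eq (hσ : HasUnitEigenvector σ) {P Q : Ideal (SkewLaurent σ)}
    [P.IsTwoSided] [Q.IsTwoSided] (h : contract P = contract Q) : P = Q := by
  ext f
  rw [mem_iff_coeff_mem_contract hσ, mem_iff_coeff_mem_contract hσ, h]

/-- The contraction of a prime ideal is `σ`-prime. -/
theorem mem_contract_or_mem_contract {P : Ideal (SkewLaurent σ)} (hP : IsPrimeTwoSided P) {a b : A}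
    (h : ∀ n : ℤ, a * (σ ^ n) b ∈ contract P) : a ∈ contract P ∨ b ∈ contract P := by
  have := hP.isTwoSided
  refine hP.mem_or_mem _ _ fun r => ?_
  rw [← sum_monomial r, Finset.mul_sum, Finset.sum_mul]
  refine P.sum_mem fun n _ => ?_
  rw [C_mul_monomial, monomial_mul_C, monomial_mem_iff, mul_right_comm]
  exact Ideal.mul_mem_right _ _ (h n)

section extend

variable (I : Ideal A) (hI : ∀ a ∈ I, ∀ n : ℤ, (σ ^ n) a ∈ I)

/-- The two-sided ideal of Laurent polynomials with coefficients in a `σ`-stable ideal. -/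
def extend : Ideal (SkewLaurent σ) where
  carrier := {f | ∀ n, f.coeff n ∈ I}
  add_mem' hf hg n := by rw [coeff_add]; exact I.add_mem (hf n) (hg n)
  zero_mem' n := by rw [coeff_zero]; exact I.zero_mem
  smul_mem' g f hf n := by
    rw [smul_eq_mul, ← sum_monomial g, Finset.sum_mul, coeff_sum]
    refine I.sum_mem fun i _ => ?_
    rw [coeff_monomial_mul]
    exact I.mul_mem_left _ (hI _ (hf _) _)

theorem mem_extend {f : SkewLaurent σ} : f ∈ extend I hI ↔ ∀ n, f.coeff n ∈ I := Iff.rfl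

instance : (extend I hI).IsTwoSided where
  mul_mem_of_left {f} g hf n := by
    rw [← sum_monomial f, Finset.sum_mul, coeff_sum]
    refine I.sum_mem fun i _ => ?_
    rw [coeff_monomial_mul]
    exact I.mul_mem_right _ (hf _)

theorem contract_extend : contract (extend I hI) = I := by
  ext a
  rw [mem_contract, mem_extend, C_apply]
  refine ⟨fun h => by simpa [coeff_monomial] using h 0, fun h n => ?_⟩
  rw [coeff_monomial]
  split_ifs
  exacts [h, I.zero_mem]

theorem isPrimeTwoSided_extend (hσ : HasUnitEigenvector σ) (htop : I ≠ ⊤)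
    (hprime : ∀ a b : A, (∀ n : ℤ, a * (σ ^ n) b ∈ I) → a ∈ I ∨ b ∈ I) :
    IsPrimeTwoSided (extend I hI) where
  isTwoSided := inferInstance
  ne_top h := htop (by rw [← contract_extend I hI, h]; exact Ideal.comap_top)
  mem_or_mem a b h := by
    set P := extend I hI
    -- Both sides of the relation `f S g ⊆ P` may be replaced by homogeneous components.
    let L (g : SkewLaurent σ) : Ideal (SkewLaurent σ) :=
      { carrier := {f | ∀ r, f * r * g ∈ P}
        add_mem' := fun hf hf' r => by
          rw [add_mul, add_mul]; exact P.add_mem (hf r) (hf' r)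
        zero_mem' := fun r => by simp
        smul_mem' := fun c f hf r => by
          rw [smul_eq_mul, mul_assoc, mul_assoc, ← mul_assoc f]; exact P.mul_mem_left _ (hf r) }
    have hL : ∀ g, (L g).IsTwoSided := fun g =>
      ⟨fun {f} c hf r => by rw [mul_assoc f]; exact hf (c * r)⟩
    let L' (f : SkewLaurent σ) : Ideal (SkewLaurent σ) :=
      { carrier := {g | ∀ r, f * r * g ∈ P}
        add_mem' := fun hg hg' r => by
          rw [mul_add]; exact P.add_mem (hg r) (hg' r)
        zero_mem' := fun r => by simp
        smul_mem' := fun c g hg r => by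
          rw [smul_eq_mul, ← mul_assoc, mul_assoc f]; exact hg (r * c) }
    have hL' : ∀ f, (L' f).IsTwoSided := fun f =>
      ⟨fun {g} c hg r => by rw [← mul_assoc]; exact P.mul_mem_right _ (hg r)⟩
    have h1 : ∀ i j, ∀ n : ℤ, a.coeff i * (σ ^ n) (b.coeff j) ∈ I := by
      intro i j n
      have h2 : a ∈ L b := h
      have h3 := (mem_iff_coeff_mem_contract hσ).1 h2 i
      have h4 : b ∈ L' (C σ (a.coeff i)) := h3
      have h5 := (mem_iff_coeff_mem_contract hσ).1 h4 j
      have h6 : C σ (a.coeff i) * monomial σ n 1 * C σ (b.coeff j) ∈ P := h5 (monomial σ n 1)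
      rw [C_mul_monomial, monomial_mul_C, monomial_mem_iff, contract_extend, mul_one] at h6
      exact h6
    by_contra! hab
    simp only [P, mem_extend, not_forall] at hab
    obtain ⟨⟨i, hi⟩, j, hj⟩ := hab
    exact (hprime _ _ (h1 i j)).elim hi hj

end extend

end SkewLaurent

end

noncomputable section

/-! ### The automorphism of the exponents -/

/-- The automorphism of `ℤ³` through which `σ` acts on the exponents of monomials. -/
def expAut : (ℤ × ℤ × ℤ) ≃ₗ[ℤ] (ℤ × ℤ × ℤ) where
  toFun v := (5 * v.1 + v.2.1, 4 * v.1 + v.2.1, v.2.2)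
  invFun v := (v.1 - v.2.1, -4 * v.1 + 5 * v.2.1, v.2.2)
  left_inv v := by ext <;> simp <;> ring
  right_inv v := by ext <;> simp <;> ring
  map_add' v w := by ext <;> simp <;> ring
  map_smul' n v := by ext <;> simp <;> ring

theorem expAut_apply (v : ℤ × ℤ × ℤ) :
    expAut v = (5 * v.1 + v.2.1, 4 * v.1 + v.2.1, v.2.2) := rfl

theorem expAut_zpow_snd_snd (n : ℤ) (v : ℤ × ℤ × ℤ) : ((expAut ^ n) v).2.2 = v.2.2 := by
  induction n generalizing v with
  | zero => simp
  | succ n ih => rw [zpow_add_one, LinearEquiv.mul_apply, ih]; rfl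
  | pred n ih => rw [zpow_sub_one, LinearEquiv.mul_apply, ih]; rfl

theorem two_zpow_injective : Function.Injective fun n : ℤ => (2 : Qbar) ^ n := fun m n h => by
  have h1 : ((2 : ℚ) ^ m) = 2 ^ n := by
    apply (algebraMap ℚ Qbar).injective
    simpa using h
  exact zpow_right_injective₀ (by norm_num) (by norm_num) h1

theorem sigma_single (v : ℤ × ℤ × ℤ) (r : Qbar) :
    sigma (AddMonoidAlgebra.single v r) = AddMonoidAlgebra.single (expAut v) (r * 2 ^ v.2.2) :=
  sigmaHom_single v.1 v.2.1 v.2.2 r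

theorem sigma_zpow_single (n : ℤ) (v : ℤ × ℤ × ℤ) (r : Qbar) :
    (sigma ^ n) (AddMonoidAlgebra.single v r) =
      AddMonoidAlgebra.single ((expAut ^ n) v) (r * 2 ^ (n * v.2.2)) := by
  have two : (2 : Qbar) ≠ 0 := two_ne_zero
  have hinv : ∀ (v : ℤ × ℤ × ℤ) (r : Qbar), sigma⁻¹ (AddMonoidAlgebra.single v r) =
      AddMonoidAlgebra.single (expAut⁻¹ v) (r * 2 ^ (-v.2.2)) := fun v r =>
    sigmaInvHom_single v.1 v.2.1 v.2.2 r
  induction n generalizing v r with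
  | zero => simp
  | succ n ih =>
    rw [zpow_add_one, AlgEquiv.mul_apply, sigma_single, ih, zpow_add_one, LinearEquiv.mul_apply,
      expAut_apply, mul_assoc, ← zpow_add₀ two]
    congr 3; dsimp only; ring
  | pred n ih =>
    rw [zpow_sub_one, AlgEquiv.mul_apply, hinv, ih, zpow_sub_one, LinearEquiv.mul_apply, mul_assoc,
      ← zpow_add₀ two]
    congr 3
    change -v.2.2 + -(n : ℤ) * v.2.2 = _
    ring

/-- For `s = ±√2`, the functional `(a, b, c) ↦ (2 + 2s) a + b` is an eigenvector of `expAut` with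
eigenvalue `3 + 2s`. -/
def expWeight (s : ℝ) : (ℤ × ℤ × ℤ) →+ ℝ where
  toFun v := (2 + 2 * s) * v.1 + v.2.1
  map_zero' := by simp
  map_add' v w := by simp; ring

theorem expWeight_apply (s : ℝ) (v : ℤ × ℤ × ℤ) : expWeight s v = (2 + 2 * s) * v.1 + v.2.1 := rfl

theorem expWeight_expAut {s : ℝ} (hs : s ^ 2 = 2) (v : ℤ × ℤ × ℤ) :
    expWeight s (expAut v) = (3 + 2 * s) * expWeight s v := by
  simp only [expWeight_apply, expAut_apply]
  push_cast
  linear_combination (-4 * (v.1 : ℝ)) * hs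

theorem expWeight_expAut_pow {s : ℝ} (hs : s ^ 2 = 2) (n : ℕ) (v : ℤ × ℤ × ℤ) :
    expWeight s ((expAut ^ n) v) = (3 + 2 * s) ^ n * expWeight s v := by
  induction n generalizing v with
  | zero => simp
  | succ n ih => rw [pow_succ, LinearEquiv.mul_apply, ih, expWeight_expAut hs]; ring

theorem eq_zero_of_expWeight_eq_zero {s : ℝ} (hs : Irrational s) {v : ℤ × ℤ × ℤ}
    (h : expWeight s v = 0) : v.1 = 0 ∧ v.2.1 = 0 := by
  rw [expWeight_apply] at h
  by_cases h1 : v.1 = 0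
  · simpa [h1] using h
  · exfalso
    have h1' : (v.1 : ℝ) ≠ 0 := Int.cast_ne_zero.2 h1
    refine hs ⟨((-v.2.1 - 2 * v.1) / (2 * v.1) : ℚ), ?_⟩
    push_cast
    rw [div_eq_iff (by simpa using h1')]
    linear_combination -h

/-- Distinct iterates of a vector outside the `u`-axis have independent `(x, y)`-parts, the
eigenvalues `3 ± 2√2` of `expAut` being real and distinct from `1`. -/
theorem expAut_pow_det_ne_zero {v : ℤ × ℤ × ℤ} (hv : ¬ (v.1 = 0 ∧ v.2.1 = 0)) {i j : ℕ}
    (hij : i < j) :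
    ((expAut ^ i) v).1 * ((expAut ^ j) v).2.1 - ((expAut ^ j) v).1 * ((expAut ^ i) v).2.1 ≠ 0 := by
  intro h
  have hs : √(2 : ℝ) ^ 2 = 2 := Real.sq_sqrt (by norm_num)
  have hs' : (-√(2 : ℝ)) ^ 2 = 2 := by rw [neg_sq, hs]
  have hp : expWeight √2 v ≠ 0 := fun h => hv (eq_zero_of_expWeight_eq_zero irrational_sqrt_two h)
  have hm : expWeight (-√2) v ≠ 0 := fun h =>
    hv (eq_zero_of_expWeight_eq_zero irrational_sqrt_two.neg h)
  have hR : (((expAut ^ i) v).1 : ℝ) * ((expAut ^ j) v).2.1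
      - ((expAut ^ j) v).1 * ((expAut ^ i) v).2.1 = 0 := by exact_mod_cast h
  have key : expWeight √2 ((expAut ^ i) v) * expWeight (-√2) ((expAut ^ j) v) =
      expWeight √2 ((expAut ^ j) v) * expWeight (-√2) ((expAut ^ i) v) := by
    simp only [expWeight_apply]
    linear_combination (4 * √2) * hR
  simp only [expWeight_expAut_pow hs, expWeight_expAut_pow hs'] at key
  have key2 : (3 + 2 * √2) ^ i * (3 + 2 * -√2) ^ j = (3 + 2 * √2) ^ j * (3 + 2 * -√2) ^ i :=
    mul_right_cancel₀ (mul_ne_zero hp hm) (by linear_combination key)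
  have hone : (3 + 2 * √2) * (3 + 2 * -√2) = 1 := by linear_combination (-4) * hs
  have hbig : 1 < 3 + 2 * √(2 : ℝ) := by have := Real.sqrt_nonneg 2; linarith
  obtain ⟨d, rfl⟩ := Nat.exists_eq_add_of_lt hij
  have hpow : ∀ m : ℕ, (3 + 2 * √(2 : ℝ)) ^ m * (3 + 2 * -√2) ^ m = 1 := fun m => by
    rw [← mul_pow, hone, one_pow]
  have h3 : (3 + 2 * -√2) ^ (d + 1) = (3 + 2 * √(2 : ℝ)) ^ (d + 1) := by
    rw [add_assoc, pow_add _ i, pow_add _ i] at key2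
    linear_combination key2 + ((3 + 2 * √(2 : ℝ)) ^ (d + 1) - (3 + 2 * -√2) ^ (d + 1)) * hpow i
  have h4 := hpow (d + 1)
  rw [h3] at h4
  have h5 := one_lt_pow₀ hbig (Nat.succ_ne_zero d)
  exact (one_lt_mul_of_lt_of_le h5 h5.le).ne' h4

/-! ### Leading terms and invariant quotients -/

/-- An injective homomorphism of `ℤ³` to an ordered group, for the order of which `expAut` is
monotone. -/
def expOrder (v : ℤ × ℤ × ℤ) : ℝ ×ₗ ℤ := toLex (expWeight √2 v, v.2.2)

theorem expOrder_add (v w : ℤ × ℤ × ℤ) : expOrder (v + w) = expOrder v + expOrder w := by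
  simp [expOrder, ← toLex_add]

theorem expOrder_injective : Function.Injective expOrder := by
  intro v w h
  have h' : (expWeight √2 v, v.2.2) = (expWeight √2 w, w.2.2) := toLex.injective h
  rw [Prod.mk.injEq] at h'
  have := eq_zero_of_expWeight_eq_zero irrational_sqrt_two (v := v - w)
    (by rw [map_sub, h'.1, sub_self])
  ext
  · exact sub_eq_zero.1 this.1
  · exact sub_eq_zero.1 this.2
  · exact h'.2

theorem expOrder_expAut_le {v w : ℤ × ℤ × ℤ} (h : expOrder v ≤ expOrder w) :
    expOrder (expAut v) ≤ expOrder (expAut w) := by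
  have hs : √(2 : ℝ) ^ 2 = 2 := Real.sq_sqrt (by norm_num)
  have hpos : 0 < 3 + 2 * √(2 : ℝ) := by have := Real.sqrt_nonneg 2; linarith
  rw [expOrder, expOrder, Prod.Lex.toLex_le_toLex] at h ⊢
  rw [expWeight_expAut hs, expWeight_expAut hs]
  rcases h with h | h
  · exact Or.inl (mul_lt_mul_of_pos_left h hpos)
  · exact Or.inr ⟨congrArg ((3 + 2 * √2) * ·) h.1, h.2⟩

/-- `v` is the leading exponent of `f`. -/
def IsTopExp (f : Laurent3) (v : ℤ × ℤ × ℤ) : Prop :=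
  f.coeff v ≠ 0 ∧ ∀ w, f.coeff w ≠ 0 → expOrder w ≤ expOrder v

theorem exists_isTopExp {f : Laurent3} (hf : f ≠ 0) : ∃ v, IsTopExp f v := by
  have hs : f.coeff.support.Nonempty := by
    rw [Finsupp.support_nonempty_iff]
    exact fun h => hf (AddMonoidAlgebra.coeff_injective h)
  obtain ⟨v, hv, hmax⟩ := f.coeff.support.exists_max_image expOrder hs
  exact ⟨v, Finsupp.mem_support_iff.1 hv, fun w hw => hmax w (Finsupp.mem_support_iff.2 hw)⟩

theorem IsTopExp.unique {f : Laurent3} {v w : ℤ × ℤ × ℤ} (hv : IsTopExp f v) (hw : IsTopExp f w) :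
    v = w :=
  expOrder_injective (le_antisymm (hw.2 v hv.1) (hv.2 w hw.1))

theorem IsTopExp.coeff_mul {f g : Laurent3} {v w : ℤ × ℤ × ℤ} (hv : IsTopExp f v)
    (hw : IsTopExp g w) : (f * g).coeff (v + w) = f.coeff v * g.coeff w := by
  refine AddMonoidAlgebra.coeff_mul_add_of_uniqueAdd fun a b ha hb hab => ?_
  have h1 := hv.2 a (Finsupp.mem_support_iff.1 ha)
  have h2 := hw.2 b (Finsupp.mem_support_iff.1 hb)
  have h3 := congrArg expOrder hab
  rw [expOrder_add, expOrder_add] at h3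
  have h4 : expOrder a = expOrder v := by
    by_contra hne
    exact absurd h3 (add_lt_add_of_lt_of_le (lt_of_le_of_ne h1 hne) h2).ne
  rw [h4] at h3
  exact ⟨expOrder_injective h4, expOrder_injective (add_left_cancel h3)⟩

theorem IsTopExp.mul {f g : Laurent3} {v w : ℤ × ℤ × ℤ} (hv : IsTopExp f v)
    (hw : IsTopExp g w) : IsTopExp (f * g) (v + w) := by
  classical
  refine ⟨by rw [hv.coeff_mul hw]; exact mul_ne_zero hv.1 hw.1, fun x hx => ?_⟩
  have := AddMonoidAlgebra.support_coeff_mul_subset f g (Finsupp.mem_support_iff.2 hx)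
  obtain ⟨a, ha, b, hb, rfl⟩ := Finset.mem_add.1 this
  rw [expOrder_add, expOrder_add]
  exact add_le_add (hv.2 a (Finsupp.mem_support_iff.1 ha)) (hw.2 b (Finsupp.mem_support_iff.1 hb))

theorem coeff_sigma (f : Laurent3) (v : ℤ × ℤ × ℤ) :
    (sigma f).coeff (expAut v) = f.coeff v * 2 ^ v.2.2 := by
  classical
  conv_lhs => rw [← AddMonoidAlgebra.sum_coeff_single f, Finsupp.sum, map_sum,
    AddMonoidAlgebra.coeff_sum, Finsupp.finsetSum_apply]
  simp only [sigma_single, AddMonoidAlgebra.coeff_single, Finsupp.single_apply, expAut.injective.eq_iff]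
  rw [Finset.sum_ite_eq']
  split_ifs with h
  · rfl
  · rw [Finsupp.notMem_support_iff.1 h, zero_mul]

theorem IsTopExp.sigma {f : Laurent3} {v : ℤ × ℤ × ℤ} (hv : IsTopExp f v) :
    IsTopExp (sigma f) (expAut v) := by
  refine ⟨by rw [coeff_sigma]; exact mul_ne_zero hv.1 (zpow_ne_zero _ two_ne_zero), fun w hw => ?_⟩
  obtain ⟨w, rfl⟩ := expAut.surjective w
  rw [coeff_sigma] at hw
  exact expOrder_expAut_le (hv.2 w (left_ne_zero_of_mul hw))

theorem expAut_sub_self {v w : ℤ × ℤ × ℤ} (h : v + expAut w = expAut v + w) :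
    v.1 = w.1 ∧ v.2.1 = w.2.1 := by
  simp only [expAut_apply, Prod.ext_iff, Prod.fst_add, Prod.snd_add] at h
  omega

/-- The only `σ`-invariant fractions are the constants. -/
theorem exists_smul_eq_of_mul_sigma_eq {p q : Laurent3} (hq : q ≠ 0)
    (h : q * sigma p = sigma q * p) : ∃ c : Qbar, p = c • q := by
  -- Leading exponents of solutions agree, as `expAut` fixes only the `u`-axis.
  have key : ∀ {p : Laurent3} {v w}, q * sigma p = sigma q * p → IsTopExp q v → IsTopExp p w →
      v = w := by
    intro p v w h hv hw
    have h1 : IsTopExp (q * sigma p) (v + expAut w) := hv.mul hw.sigma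
    have h2 : IsTopExp (q * sigma p) (expAut v + w) := h ▸ hv.sigma.mul hw
    have h3 := h1.unique h2
    have h4 := hv.coeff_mul hw.sigma
    rw [h3, h, hv.sigma.coeff_mul hw, coeff_sigma, coeff_sigma] at h4
    have h5 : (2 : Qbar) ^ v.2.2 = 2 ^ w.2.2 := by
      have := mul_ne_zero hv.1 hw.1
      exact mul_left_cancel₀ this (by linear_combination h4)
    have h6 := expAut_sub_self h3
    have h7 : v.2.2 = w.2.2 := two_zpow_injective h5
    ext
    exacts [h6.1, h6.2, h7]
  by_cases hp : p = 0
  · exact ⟨0, by rw [hp, zero_smul]⟩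
  obtain ⟨v, hv⟩ := exists_isTopExp hq
  obtain ⟨w, hw⟩ := exists_isTopExp hp
  obtain rfl := key h hv hw
  refine ⟨p.coeff v / q.coeff v, ?_⟩
  by_contra hne
  obtain ⟨x, hx⟩ := exists_isTopExp (sub_ne_zero.2 hne)
  obtain rfl := key (by
    rw [map_sub, map_smul, mul_sub, mul_sub, h, mul_smul_comm, mul_smul_comm,
      mul_comm q (sigma q)]) hv hx
  refine hx.1 ?_
  simp [div_mul_cancel₀ _ hv.1]

/-! ### Homogeneous elements of stable ideals -/

/-- `f` is homogeneous of degree `c` in `u`. -/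
def UHomogeneous (c : ℤ) (f : Laurent3) : Prop := ∀ v, f.coeff v ≠ 0 → v.2.2 = c

theorem UHomogeneous.mul {c d : ℤ} {f g : Laurent3} (hf : UHomogeneous c f)
    (hg : UHomogeneous d g) : UHomogeneous (c + d) (f * g) := by
  classical
  intro x hx
  have := AddMonoidAlgebra.support_coeff_mul_subset f g (Finsupp.mem_support_iff.2 hx)
  obtain ⟨a, ha, b, hb, rfl⟩ := Finset.mem_add.1 this
  rw [Prod.snd_add, Prod.snd_add, hf a (Finsupp.mem_support_iff.1 ha),
    hg b (Finsupp.mem_support_iff.1 hb)]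

theorem UHomogeneous.sub {c : ℤ} {f g : Laurent3} (hf : UHomogeneous c f)
    (hg : UHomogeneous c g) : UHomogeneous c (f - g) := by
  intro x hx
  by_cases h : f.coeff x = 0
  · exact hg x fun h' => hx (by simp [h, h'])
  · exact hf x h

theorem UHomogeneous.sigma {c : ℤ} {f : Laurent3} (hf : UHomogeneous c f) :
    UHomogeneous c (sigma f) := by
  intro x hx
  obtain ⟨w, rfl⟩ := expAut.surjective x
  rw [coeff_sigma] at hx
  exact hf w (left_ne_zero_of_mul hx)

theorem exists_sum_uHomogeneous (f : Laurent3) : ∃ (s : Finset ℤ) (v : ℤ → Laurent3),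
    (∀ c, UHomogeneous c (v c)) ∧ ∑ c ∈ s, v c = f := by
  classical
  refine ⟨f.coeff.support.image fun v => v.2.2, fun c =>
    ∑ v ∈ f.coeff.support with v.2.2 = c, AddMonoidAlgebra.single v (f.coeff v), fun c x hx => ?_, ?_⟩
  · by_contra hne
    refine hx ?_
    rw [AddMonoidAlgebra.coeff_sum, Finsupp.finsetSum_apply]
    refine Finset.sum_eq_zero fun w hw => ?_
    rw [AddMonoidAlgebra.coeff_single, Finsupp.single_apply, if_neg]
    rintro rfl
    exact hne (Finset.mem_filter.1 hw).2
  · rw [Finset.sum_fiberwise_of_maps_to fun v hv => Finset.mem_image_of_mem _ hv]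
    exact AddMonoidAlgebra.sum_coeff_single f

/-- A nonzero `σ`-stable ideal contains a nonzero element that is homogeneous in `u`: if `v` is a
homogeneous component of an element `f`, then `v σ(f) - σ(v) f` has fewer components, and it
vanishes only if `f` is homogeneous. -/
theorem exists_uHomogeneous_mem {I : Ideal Laurent3} (hI : ∀ a ∈ I, sigma a ∈ I) (hne : I ≠ ⊥) :
    ∃ c, ∃ h ∈ I, h ≠ 0 ∧ UHomogeneous c h := by
  classical
  have key : ∀ (s : Finset ℤ) (d : ℤ) (v : ℤ → Laurent3), (∀ c, UHomogeneous (c + d) (v c)) →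
      ∑ c ∈ s, v c ∈ I → (∃ c ∈ s, v c ≠ 0) → ∃ c, ∃ h ∈ I, h ≠ 0 ∧ UHomogeneous c h := by
    intro s
    induction s using Finset.induction_on with
    | empty => simp
    | insert a s ha ih =>
      intro d v hv hsum hnz
      by_cases hva : v a = 0
      · rw [Finset.sum_insert ha, hva, zero_add] at hsum
        refine ih d v hv hsum ?_
        obtain ⟨c, hc, hvc⟩ := hnz
        rcases Finset.mem_insert.1 hc with rfl | hc
        exacts [absurd hva hvc, ⟨c, hc, hvc⟩]
      by_cases hzero : ∀ c ∈ s, v a * sigma (v c) - sigma (v a) * v c = 0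
      · refine ⟨a + d, v a, ?_, hva, hv a⟩
        have hs : ∀ c ∈ s, v c = 0 := fun c hc => by
          obtain ⟨κ, hκ⟩ := exists_smul_eq_of_mul_sigma_eq hva (sub_eq_zero.1 (hzero c hc))
          by_contra hvc
          obtain ⟨x, hx⟩ := exists_isTopExp hvc
          have h1 := hv c x hx.1
          have h2 := hv a x fun h => hx.1 (by rw [hκ]; simp [h])
          exact ha ((by omega : c = a) ▸ hc)
        rwa [Finset.sum_insert ha, Finset.sum_eq_zero hs, add_zero] at hsum
      · refine ih (a + d + d) (fun c => v a * sigma (v c) - sigma (v a) * v c) (fun c => ?_) ?_ ?_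
        · have h1 := (hv a).mul (hv c).sigma
          have h2 := (hv a).sigma.mul (hv c)
          rw [show c + (a + d + d) = a + d + (c + d) by ring]
          exact h1.sub h2
        · have h1 := I.sub_mem (I.mul_mem_left (v a) (hI _ hsum))
            (I.mul_mem_left (sigma (v a)) hsum)
          rw [Finset.sum_insert ha, map_add, map_sum, mul_add, mul_add, Finset.mul_sum,
            Finset.mul_sum] at h1
          rw [Finset.sum_sub_distrib]
          convert h1 using 1
          ring
        · push Not at hzero
          exact hzero
  obtain ⟨f, hf, hf0⟩ := Submodule.exists_mem_ne_zero_of_ne_bot hne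
  obtain ⟨s, v, hv, rfl⟩ := exists_sum_uHomogeneous f
  refine key s 0 v (by simpa using hv) hf ?_
  by_contra! h
  exact hf0 (Finset.sum_eq_zero h)

end

noncomputable section

/-! ### Valuations and primes containing a stable ideal -/

/-- An element of a field extension `K` of `k` is algebraic over `k` as soon as it has value `1`
for all valuations of `K` that are trivial on `k`. -/
theorem isAlgebraic_of_forall_valuation_eq_one {k K : Type*} [Field k] [Field K] [Algebra k K]
    (x : K)
    (h : ∀ V : ValuationSubring K, (∀ c : k, algebraMap k K c ∈ V) → V.valuation x = 1) :
    IsAlgebraic k x := by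
  by_contra hx
  have hx' : x ∉ (integralClosure k K).toSubring := fun hx' => hx (IsIntegral.isAlgebraic hx')
  obtain ⟨V, hV, hxV⟩ := Subring.exists_le_valuationSubring_of_isIntegrallyClosedIn hx'
  refine hxV ((V.valuation_le_one_iff x).1 (h V fun c => hV ?_).le)
  exact (integralClosure k K).algebraMap_mem c

/-- The unit `x^a y^b u^c` of the Laurent polynomial ring, as a homomorphism in `(a, b, c)`. -/
def monomialUnit : Multiplicative (ℤ × ℤ × ℤ) →* Laurent3ˣ :=
  (AddMonoidAlgebra.of Qbar (ℤ × ℤ × ℤ)).toHomUnits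

theorem monomialUnit_ofAdd (v : ℤ × ℤ × ℤ) :
    (monomialUnit (Multiplicative.ofAdd v) : Laurent3) = AddMonoidAlgebra.single v 1 := rfl

theorem sigma_pow_single (n : ℕ) (v : ℤ × ℤ × ℤ) (r : Qbar) :
    (sigma ^ n) (AddMonoidAlgebra.single v r) =
      AddMonoidAlgebra.single ((expAut ^ n) v) (r * 2 ^ (n * v.2.2)) := by
  have := sigma_zpow_single n v r
  rwa [zpow_natCast, zpow_natCast] at this

theorem single_eq_smul_monomial (v : ℤ × ℤ × ℤ) (r : Qbar) :
    (AddMonoidAlgebra.single v r : Laurent3) = r • AddMonoidAlgebra.single v 1 := by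
  rw [AddMonoidAlgebra.smul_single, smul_eq_mul, mul_one]

section valuation

variable {K : Type*} [Field K] [Algebra Qbar K] (φ : Laurent3 →ₐ[Qbar] K)

/-- A relation between monomials forces two of its terms to have the same value. -/
theorem exists_valuation_eq_of_map_sigma_pow_eq_zero {V : ValuationSubring K}
    (hV : ∀ c : Qbar, algebraMap Qbar K c ∈ V) {h : Laurent3} (hne : h ≠ 0) {j : ℕ}
    (hj : φ ((sigma ^ j) h) = 0) :
    ∃ v ∈ h.coeff.support, ∃ w ∈ h.coeff.support, v ≠ w ∧
      V.valuation (φ (AddMonoidAlgebra.single ((expAut ^ j) v) 1)) =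
        V.valuation (φ (AddMonoidAlgebra.single ((expAut ^ j) w) 1)) := by
  classical
  have hunit : ∀ c : Qbar, c ≠ 0 → V.valuation (algebraMap Qbar K c) = 1 := by
    intro c hc
    refine le_antisymm ((V.valuation_le_one_iff _).2 (hV c)) ?_
    have h1 := (V.valuation_le_one_iff _).2 (hV c⁻¹)
    rw [map_inv₀, map_inv₀] at h1
    exact (inv_le_one₀ (zero_lt_iff.2 (by simpa using hc))).1 h1
  by_contra! hinj
  have hs : h.coeff.support.Nonempty := by
    rw [Finsupp.support_nonempty_iff]
    exact fun h0 => hne (AddMonoidAlgebra.coeff_injective h0)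
  let g : ℤ × ℤ × ℤ → K := fun v => φ ((sigma ^ j) (AddMonoidAlgebra.single v (h.coeff v)))
  have hg : ∀ v ∈ h.coeff.support, V.valuation (g v) =
      V.valuation (φ (AddMonoidAlgebra.single ((expAut ^ j) v) 1)) := by
    intro v hv
    simp only [g]
    rw [sigma_pow_single, single_eq_smul_monomial, map_smul, Algebra.smul_def, map_mul,
      hunit _ (mul_ne_zero (Finsupp.mem_support_iff.1 hv) (zpow_ne_zero _ two_ne_zero)), one_mul]
  have hsum : ∑ v ∈ h.coeff.support, g v = 0 := by
    rw [← hj]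
    conv_rhs => rw [← AddMonoidAlgebra.sum_coeff_single h, Finsupp.sum, map_sum, map_sum]
  obtain ⟨v, hv, hmax⟩ := h.coeff.support.exists_max_image (fun v => V.valuation (g v)) hs
  have h1 := Valuation.map_sum_eq_of_lt V.valuation hv (f := g) fun w hw => by
    obtain ⟨hw, hwv⟩ := Finset.mem_sdiff.1 hw
    refine lt_of_le_of_ne (hmax w hw) fun he => ?_
    rw [hg w hw, hg v hv] at he
    exact hinj w hw v hv (by simpa using hwv) he
  rw [hsum, map_zero, hg v hv] at h1
  have h2 : IsUnit (φ (AddMonoidAlgebra.single ((expAut ^ j) v) 1)) :=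
    (monomialUnit (Multiplicative.ofAdd ((expAut ^ j) v))).isUnit.map φ
  exact h2.ne_zero ((map_eq_zero _).1 h1.symm)

/-- If `φ` kills all iterates of a nonzero homogeneous element, then all monomials in `x` and `y`
have value `1`. By the pigeonhole principle some two exponents of that element produce terms of
equal value for two different iterates; the differences of the two pairs of exponents span
`ℚ²`. -/
theorem valuation_map_single_eq_one {V : ValuationSubring K}
    (hV : ∀ c : Qbar, algebraMap Qbar K c ∈ V) {h : Laurent3} (hne : h ≠ 0) {c : ℤ}
    (hc : UHomogeneous c h) (hj : ∀ j : ℕ, φ ((sigma ^ j) h) = 0) (a b : ℤ) :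
    V.valuation (φ (AddMonoidAlgebra.single (a, b, 0) 1)) = 1 := by
  classical
  -- The value of a monomial, as a homomorphism on the group of exponents.
  let N : Multiplicative (ℤ × ℤ × ℤ) →* V.ValueGroupˣ :=
    (Units.map (V.valuation.toMonoidWithZeroHom : K →* V.ValueGroup)).comp
      ((Units.map (φ : Laurent3 →* K)).comp monomialUnit)
  have hN : ∀ v, ((N (Multiplicative.ofAdd v) : V.ValueGroupˣ) : V.ValueGroup) =
      V.valuation (φ (AddMonoidAlgebra.single v 1)) := fun v => rfl
  have hex := fun j => exists_valuation_eq_of_map_sigma_pow_eq_zero φ hV hne (hj j)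
  choose f hf g hg hfg hval using hex
  obtain ⟨i, j, hij, he⟩ := Finite.exists_ne_map_eq_of_infinite
    (fun j : ℕ => ((⟨f j, hf j⟩, ⟨g j, hg j⟩) : h.coeff.support × h.coeff.support))
  wlog hlt : i < j generalizing i j
  · exact this j i hij.symm he.symm (lt_of_le_of_ne (not_lt.1 hlt) hij.symm)
  simp only [Prod.mk.injEq, Subtype.mk.injEq] at he
  have hker : ∀ m, f m = f i → g m = g i →
      N (Multiplicative.ofAdd ((expAut ^ m) (f i - g i))) = 1 := by
    intro m h1 h2
    have h3 : N (Multiplicative.ofAdd ((expAut ^ m) (f m))) =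
        N (Multiplicative.ofAdd ((expAut ^ m) (g m))) := Units.ext (hval m)
    rw [map_sub, ofAdd_sub, map_div, ← h1, ← h2, h3, div_self']
  set e := f i - g i with he_def
  have he2 : e.2.2 = 0 := by
    rw [he_def, Prod.snd_sub, Prod.snd_sub, hc _ (Finsupp.mem_support_iff.1 (hf i)),
      hc _ (Finsupp.mem_support_iff.1 (hg i)), sub_self]
  have he0 : ¬ (e.1 = 0 ∧ e.2.1 = 0) := fun h0 =>
    hfg i (sub_eq_zero.1 (Prod.ext h0.1 (Prod.ext h0.2 he2)))
  have hdet := expAut_pow_det_ne_zero he0 hlt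
  have hi := hker i rfl rfl
  have hj' := hker j he.1.symm he.2.symm
  have hX : ((expAut ^ i) e).2.2 = 0 := by
    have := expAut_zpow_snd_snd i e; rwa [zpow_natCast, he2] at this
  have hY : ((expAut ^ j) e).2.2 = 0 := by
    have := expAut_zpow_snd_snd j e; rwa [zpow_natCast, he2] at this
  set X := (expAut ^ i) e
  set Y := (expAut ^ j) e
  set Δ := X.1 * Y.2.1 - Y.1 * X.2.1
  -- Cramer's rule
  have hcr : Δ • ((a, b, 0) : ℤ × ℤ × ℤ) =
      (a * Y.2.1 - Y.1 * b) • X + (X.1 * b - a * X.2.1) • Y := by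
    ext
    · simp [Δ]; ring
    · simp [Δ]; ring
    · simp [hX, hY]
  have hpow : N (Multiplicative.ofAdd (a, b, 0)) ^ Δ = 1 := by
    rw [← map_zpow, ← ofAdd_zsmul, hcr, ofAdd_add, ofAdd_zsmul, ofAdd_zsmul, map_mul, map_zpow,
      map_zpow, hi, hj', one_zpow, one_zpow, one_mul]
  have h1 : N (Multiplicative.ofAdd (a, b, 0)) = 1 := by
    have hn : N (Multiplicative.ofAdd (a, b, 0)) ^ Δ.natAbs = 1 := by
      rcases Int.natAbs_eq Δ with h | h
      · rw [h, zpow_natCast] at hpow; exact hpow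
      · rw [h, zpow_neg, zpow_natCast, inv_eq_one] at hpow; exact hpow
    refine Units.ext ((pow_eq_one_iff_of_nonneg zero_le (Int.natAbs_ne_zero.2 hdet)).1 ?_)
    rw [← Units.val_pow_eq_pow_val, hn, Units.val_one]
  rw [← hN, h1, Units.val_one]

end valuation

/-! ### Points of the torus and their orbits -/

/-- The torus `(k^×)²`, in which the pair `(x, y)` takes its values. -/
abbrev Torus2 : Type := Qbarˣ × Qbarˣ

/-- The value of the monomial `x^a y^b u^c` at a point of the `(x, y)`-torus, for `u = 1`. -/
def torusChar (o : Torus2) : Multiplicative (ℤ × ℤ × ℤ) →* Qbarˣ where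
  toFun v := o.1 ^ v.toAdd.1 * o.2 ^ v.toAdd.2.1
  map_one' := by simp
  map_mul' v w := by
    simp only [toAdd_mul, Prod.fst_add, Prod.snd_add, zpow_add]
    exact mul_mul_mul_comm _ _ _ _

theorem torusChar_ofAdd (o : Torus2) (v : ℤ × ℤ × ℤ) :
    torusChar o (Multiplicative.ofAdd v) = o.1 ^ v.1 * o.2 ^ v.2.1 := rfl

/-- Evaluation of `x` and `y` at a point of the torus, with values in `k[u^{±1}]`. -/
def torusEval (o : Torus2) : Laurent3 →ₐ[Qbar] AddMonoidAlgebra Qbar ℤ :=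
  AddMonoidAlgebra.lift Qbar _ _
    { toFun := fun v => AddMonoidAlgebra.single v.toAdd.2.2 (torusChar o v : Qbar)
      map_one' := by rw [map_one (torusChar o)]; rfl
      map_mul' := fun v w => by
        rw [AddMonoidAlgebra.single_mul_single, map_mul (torusChar o), Units.val_mul]; rfl }

theorem torusEval_single (o : Torus2) (v : ℤ × ℤ × ℤ) (r : Qbar) :
    torusEval o (AddMonoidAlgebra.single v r) =
      AddMonoidAlgebra.single v.2.2 (r * torusChar o (Multiplicative.ofAdd v)) := by
  rw [torusEval, AddMonoidAlgebra.lift_single]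
  exact AddMonoidAlgebra.smul_single _ _ _

theorem ker_torusEval_isPrime (o : Torus2) : (RingHom.ker (torusEval o)).IsPrime :=
  RingHom.ker_isPrime _

/-- The `n`th iterate of the automorphism of the torus dual to `σ`. -/
def torusAct (n : ℤ) (o : Torus2) : Torus2 :=
  (torusChar o (Multiplicative.ofAdd ((expAut ^ n) (1, 0, 0))),
    torusChar o (Multiplicative.ofAdd ((expAut ^ n) (0, 1, 0))))

theorem monoidHom_multiplicative_int3_apply {G : Type*} [Group G]
    (F : Multiplicative (ℤ × ℤ × ℤ) →* G) (v : ℤ × ℤ × ℤ) :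
    F (Multiplicative.ofAdd v) = F (Multiplicative.ofAdd (1, 0, 0)) ^ v.1 *
      F (Multiplicative.ofAdd (0, 1, 0)) ^ v.2.1 * F (Multiplicative.ofAdd (0, 0, 1)) ^ v.2.2 := by
  rw [← map_zpow F, ← map_zpow F, ← map_zpow F, ← map_mul F, ← map_mul F, ← ofAdd_zsmul,
    ← ofAdd_zsmul, ← ofAdd_zsmul, ← ofAdd_add, ← ofAdd_add]
  congr 2
  ext <;> simp

theorem expAut_zpow_u (n : ℤ) : (expAut ^ n) (0, 0, 1) = (0, 0, 1) := by
  induction n with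
  | zero => simp
  | succ n ih => rw [zpow_add_one, LinearEquiv.mul_apply]; exact ih
  | pred n ih => rw [zpow_sub_one, LinearEquiv.mul_apply]; exact ih

theorem torusChar_torusAct (n : ℤ) (o : Torus2) (v : ℤ × ℤ × ℤ) :
    torusChar (torusAct n o) (Multiplicative.ofAdd v) =
      torusChar o (Multiplicative.ofAdd ((expAut ^ n) v)) := by
  have := monoidHom_multiplicative_int3_apply
    ((torusChar o).comp (AddMonoidHom.toMultiplicative (expAut ^ n).toLinearMap.toAddMonoidHom)) v
  have h1 : torusChar o (Multiplicative.ofAdd (0, 0, 1)) = 1 := by simp [torusChar_ofAdd]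
  have h2 := expAut_zpow_u n
  change torusChar o (Multiplicative.ofAdd ((expAut ^ n) v)) =
    torusChar o (Multiplicative.ofAdd ((expAut ^ n) (1, 0, 0))) ^ v.1 *
    torusChar o (Multiplicative.ofAdd ((expAut ^ n) (0, 1, 0))) ^ v.2.1 *
    torusChar o (Multiplicative.ofAdd ((expAut ^ n) (0, 0, 1))) ^ v.2.2 at this
  rw [this, h2, h1, one_zpow, mul_one]
  rfl

/-- `σⁿ` corresponds to the action on the torus followed by the rescaling of `u`. -/
theorem torusEval_sigma_zpow_eq_zero {n : ℤ} {o : Torus2} {f : Laurent3}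
    (h : torusEval (torusAct n o) f = 0) : torusEval o ((sigma ^ n) f) = 0 := by
  let θ : AddMonoidAlgebra Qbar ℤ →ₐ[Qbar] AddMonoidAlgebra Qbar ℤ :=
    AddMonoidAlgebra.lift Qbar _ _
      { toFun := fun c => AddMonoidAlgebra.single c.toAdd ((2 : Qbar) ^ (n * c.toAdd))
        map_one' := by rw [toAdd_one, mul_zero, zpow_zero]; rfl
        map_mul' := fun c d => by
          rw [AddMonoidAlgebra.single_mul_single, ← zpow_add₀ two_ne_zero, ← mul_add]; rfl }
  have hθ : (torusEval o).comp ((sigma ^ n : Laurent3 ≃ₐ[Qbar] Laurent3) : Laurent3 →ₐ[Qbar] _) =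
      θ.comp (torusEval (torusAct n o)) := by
    refine AddMonoidAlgebra.algHom_ext (fun v => ?_) (Subsingleton.elim _ _)
    rw [AlgHom.comp_apply, AlgHom.comp_apply, torusEval_single, torusChar_torusAct]
    change torusEval o ((sigma ^ n) _) = _
    rw [sigma_zpow_single, torusEval_single, expAut_zpow_snd_snd]
    simp only [θ, AddMonoidAlgebra.lift_single, MonoidHom.coe_mk, OneHom.coe_mk,
      AddMonoidAlgebra.smul_single, toAdd_ofAdd, smul_eq_mul]
    congr 1
    ring
  have := DFunLike.congr_fun hθ f
  rw [AlgHom.comp_apply, AlgHom.comp_apply, h, map_zero] at this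
  exact this

/-- A prime ideal containing a nonzero `σ`-stable ideal lies over a single point of the torus. -/
theorem exists_ker_torusEval_le {I : Ideal Laurent3} (hI : ∀ a ∈ I, ∀ n : ℤ, (sigma ^ n) a ∈ I)
    (hne : I ≠ ⊥) {p : Ideal Laurent3} [hp : p.IsPrime] (hIp : I ≤ p) :
    ∃ o, RingHom.ker (torusEval o) ≤ p := by
  obtain ⟨c, h, hh, hne, hc⟩ := exists_uHomogeneous_mem (fun a ha => by simpa using hI a ha 1) hne
  let K := FractionRing (Laurent3 ⧸ p)
  let π : Laurent3 →ₐ[Qbar] Laurent3 ⧸ p := Ideal.Quotient.mkₐ Qbar p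
  let ι : (Laurent3 ⧸ p) →ₐ[Qbar] K := IsScalarTower.toAlgHom Qbar (Laurent3 ⧸ p) K
  have hι : Function.Injective ι := IsFractionRing.injective (Laurent3 ⧸ p) K
  have halg : ∀ a b : ℤ, ∃ c : Qbar, π (AddMonoidAlgebra.single (a, b, 0) 1) =
      algebraMap Qbar (Laurent3 ⧸ p) c := by
    intro a b
    have h1 : IsAlgebraic Qbar ((ι.comp π) (AddMonoidAlgebra.single (a, b, 0) 1)) := by
      refine isAlgebraic_of_forall_valuation_eq_one _ fun V hV =>
        valuation_map_single_eq_one (ι.comp π) hV hne hc (fun j => ?_) a b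
      have h2 := hI h hh j
      rw [zpow_natCast] at h2
      have h3 : π ((sigma ^ j) h) = 0 := Ideal.Quotient.eq_zero_iff_mem.2 (hIp h2)
      rw [AlgHom.comp_apply, h3, map_zero]
    obtain ⟨c, hc⟩ := minpoly.mem_range_of_degree_eq_one Qbar _
      (IsAlgClosed.degree_eq_one_of_irreducible Qbar (minpoly.irreducible h1.isIntegral))
    exact ⟨c, hι (by rw [AlgHom.commutes]; exact hc.symm)⟩
  let U : Multiplicative (ℤ × ℤ × ℤ) →* (Laurent3 ⧸ p)ˣ :=
    (Units.map (π : Laurent3 →* Laurent3 ⧸ p)).comp monomialUnit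
  have hU : ∀ v, ((U (Multiplicative.ofAdd v) : (Laurent3 ⧸ p)ˣ) : Laurent3 ⧸ p) =
      π (AddMonoidAlgebra.single v 1) := fun _ => rfl
  have hval : ∀ a b : ℤ, ∃ c : Qbarˣ,
      U (Multiplicative.ofAdd (a, b, 0)) = Units.map (algebraMap Qbar (Laurent3 ⧸ p)) c := by
    intro a b
    obtain ⟨c, hc⟩ := halg a b
    have hc0 : c ≠ 0 := by
      rintro rfl
      rw [map_zero, ← hU] at hc
      exact Units.ne_zero _ hc
    exact ⟨Units.mk0 c hc0, Units.ext hc⟩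
  obtain ⟨α, hα⟩ := hval 1 0
  obtain ⟨β, hβ⟩ := hval 0 1
  let ψ : AddMonoidAlgebra Qbar ℤ →ₐ[Qbar] Laurent3 ⧸ p :=
    AddMonoidAlgebra.lift Qbar _ _
      ((Units.coeHom (Laurent3 ⧸ p)).comp (zpowersHom _ (U (Multiplicative.ofAdd (0, 0, 1)))))
  have hψ : ψ.comp (torusEval (α, β)) = π := by
    refine AddMonoidAlgebra.algHom_ext (fun v => ?_) (Subsingleton.elim _ _)
    rw [AlgHom.comp_apply, torusEval_single, ← hU, monoidHom_multiplicative_int3_apply U, hα, hβ,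
      one_mul, torusChar_ofAdd, ← map_zpow, ← map_zpow, ← map_mul]
    simp only [ψ, AddMonoidAlgebra.lift_single, Algebra.smul_def]
    rfl
  refine ⟨(α, β), fun f hf => Ideal.Quotient.eq_zero_iff_mem.1 ?_⟩
  change π f = 0
  rw [← hψ, AlgHom.comp_apply, (RingHom.mem_ker).1 hf, map_zero]

end

noncomputable section

/-! ### The nonzero stable prime ideals of the Laurent polynomial ring -/

instance : IsNoetherianRing Laurent3 :=
  Algebra.FiniteType.isNoetherianRing Qbar Laurent3

theorem single_sub_mem_ker_torusEval (o : Torus2) (v : ℤ × ℤ × ℤ) (hv : v.2.2 = 0) :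
    AddMonoidAlgebra.single v 1 -
      algebraMap Qbar Laurent3 (torusChar o (Multiplicative.ofAdd v)) ∈
        RingHom.ker (torusEval o) := by
  rw [RingHom.mem_ker, map_sub, AlgHom.commutes, torusEval_single, hv, one_mul, sub_eq_zero]
  rfl

theorem eq_of_ker_torusEval_le {o o' : Torus2} {p : Ideal Laurent3} (hp : p ≠ ⊤)
    (h : RingHom.ker (torusEval o) ≤ p) (h' : RingHom.ker (torusEval o') ≤ p) : o = o' := by
  have key : ∀ v : ℤ × ℤ × ℤ, v.2.2 = 0 →
      torusChar o (Multiplicative.ofAdd v) = torusChar o' (Multiplicative.ofAdd v) := by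
    intro v hv
    have h1 := p.sub_mem (h (single_sub_mem_ker_torusEval o v hv))
      (h' (single_sub_mem_ker_torusEval o' v hv))
    rw [sub_sub_sub_cancel_left, ← map_sub] at h1
    by_contra hne
    refine hp (Ideal.eq_top_of_isUnit_mem _ h1 (IsUnit.map _ (isUnit_iff_ne_zero.2 ?_)))
    exact sub_ne_zero.2 fun he => hne (Units.ext he.symm)
  have h1 := key (1, 0, 0) rfl
  have h2 := key (0, 1, 0) rfl
  rw [torusChar_ofAdd, torusChar_ofAdd] at h1 h2
  exact Prod.ext (by simpa using h1) (by simpa using h2)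

/-- Only finitely many points of the torus lie under primes containing a nonzero stable ideal `I`,
since each such point lies under a minimal prime of `I`. -/
theorem finite_setOf_ker_torusEval_le {I : Ideal Laurent3}
    (hI : ∀ a ∈ I, ∀ n : ℤ, (sigma ^ n) a ∈ I) (hne : I ≠ ⊥) :
    {o | ∃ p : Ideal Laurent3, p.IsPrime ∧ I ≤ p ∧ RingHom.ker (torusEval o) ≤ p}.Finite := by
  refine Set.Finite.subset (Set.Finite.biUnion
    (Ideal.finite_minimalPrimes_of_isNoetherianRing Laurent3 I)
    (t := fun q => {o | q ≠ ⊤ ∧ RingHom.ker (torusEval o) ≤ q}) fun q _ =>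
      Set.Subsingleton.finite fun o ho o' ho' => eq_of_ker_torusEval_le ho.1 ho.2 ho'.2) ?_
  rintro o ⟨p, hp, hIp, hop⟩
  obtain ⟨q, hq, hqp⟩ := Ideal.exists_minimalPrimes_le hIp
  have hq' : q.IsPrime := hq.1.1
  obtain ⟨o', ho'⟩ := exists_ker_torusEval_le hI hne hq.1.2
  obtain rfl := eq_of_ker_torusEval_le hp.ne_top hop (ho'.trans hqp)
  exact Set.mem_biUnion hq ⟨hq'.ne_top, ho'⟩

/-- The ideal of the orbit of a point of the torus, or rather of the union of the corresponding
translates of the `u`-axis. -/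
def orbitIdeal (o : Torus2) : Ideal Laurent3 :=
  ⨅ n : ℤ, (RingHom.ker (torusEval o)).comap (sigma ^ n : Laurent3 ≃ₐ[Qbar] Laurent3)

theorem mem_orbitIdeal {o : Torus2} {f : Laurent3} :
    f ∈ orbitIdeal o ↔ ∀ n : ℤ, torusEval o ((sigma ^ n) f) = 0 := by
  simp only [orbitIdeal, Submodule.mem_iInf]
  rfl

theorem sigma_zpow_mem_orbitIdeal {o : Torus2} :
    ∀ f ∈ orbitIdeal o, ∀ n : ℤ, (sigma ^ n) f ∈ orbitIdeal o := by
  intro f hf n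
  rw [mem_orbitIdeal] at hf ⊢
  intro m
  rw [← AlgEquiv.mul_apply, ← zpow_add]
  exact hf _

theorem orbitIdeal_le_ker (o : Torus2) : orbitIdeal o ≤ RingHom.ker (torusEval o) := fun f hf => by
  simpa using mem_orbitIdeal.1 hf 0

theorem orbitIdeal_ne_top (o : Torus2) : orbitIdeal o ≠ ⊤ := fun h =>
  (ker_torusEval_isPrime o).ne_top (top_le_iff.1 (h ▸ orbitIdeal_le_ker o))

theorem mem_or_mem_orbitIdeal {o : Torus2} (a b : Laurent3)
    (h : ∀ n : ℤ, a * (sigma ^ n) b ∈ orbitIdeal o) : a ∈ orbitIdeal o ∨ b ∈ orbitIdeal o := by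
  by_contra! hab
  simp only [mem_orbitIdeal, not_forall] at hab
  obtain ⟨⟨i, hi⟩, j, hj⟩ := hab
  have h1 := mem_orbitIdeal.1 (h (j - i)) i
  rw [map_mul, map_mul, ← AlgEquiv.mul_apply, ← zpow_add, add_sub_cancel] at h1
  exact (mul_eq_zero.1 h1).elim hi hj

theorem orbitIdeal_torusAct_le (n : ℤ) (o : Torus2) :
    orbitIdeal (torusAct n o) ≤ orbitIdeal o := by
  intro f hf
  rw [mem_orbitIdeal] at hf ⊢
  intro m
  have := torusEval_sigma_zpow_eq_zero (hf (m - n))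
  rwa [← AlgEquiv.mul_apply, ← zpow_add, add_sub_cancel] at this

theorem ker_torusEval_torusAct_le_comap {o : Torus2} {p : Ideal Laurent3}
    (h : RingHom.ker (torusEval o) ≤ p) (n : ℤ) :
    RingHom.ker (torusEval (torusAct n o)) ≤
      p.comap (sigma ^ n : Laurent3 ≃ₐ[Qbar] Laurent3) :=
  fun _ hf => h (torusEval_sigma_zpow_eq_zero hf)

/-- A nonzero stable ideal `I` that is prime with respect to stable ideals is the ideal of a finite
orbit. Let `p` be an associated prime of `I`, and `o` the point of the torus below `p`. Then `I` is
the intersection of the iterates of `p`. Some power `T` of `σ` acts trivially on the `(x, y)`-part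
modulo `I`, so it is diagonal there for the grading by the degree in `u`, with distinct
eigenvalues; so `I` is homogeneous in `u`, and `p` may be replaced by the kernel of evaluation
at `o`. -/
theorem exists_eq_orbitIdeal {I : Ideal Laurent3} (hI : ∀ a ∈ I, ∀ n : ℤ, (sigma ^ n) a ∈ I)
    (hne : I ≠ ⊥) (htop : I ≠ ⊤)
    (hprime : ∀ a b : Laurent3, (∀ n : ℤ, a * (sigma ^ n) b ∈ I) → a ∈ I ∨ b ∈ I) :
    ∃ o, I = orbitIdeal o ∧ (Set.range fun n => torusAct n o).Finite := by
  have : Nontrivial (Laurent3 ⧸ I) := Ideal.Quotient.nontrivial_iff.2 htop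
  obtain ⟨p, hp, -⟩ := exists_le_isAssociatedPrime_of_isNoetherianRing Laurent3
    (1 : Laurent3 ⧸ I) one_ne_zero
  obtain ⟨hpp, x, hx⟩ := isAssociatedPrime_iff.1 hp
  obtain ⟨b, rfl⟩ := Ideal.Quotient.mk_surjective x
  have hpb : ∀ a, a ∈ p ↔ a * b ∈ I := by
    intro a
    rw [hx, Submodule.mem_colon_singleton, Submodule.mem_bot, ← Ideal.Quotient.eq_zero_iff_mem,
      map_mul]
    rfl
  have hb : b ∉ I := fun hb => hpp.ne_top ((Ideal.eq_top_iff_one p).2 ((hpb 1).2 (by rwa [one_mul])))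
  have hIp : I ≤ p := fun a ha => (hpb a).2 (I.mul_mem_right _ ha)
  have hinter : ∀ a, (∀ n : ℤ, (sigma ^ n) a ∈ p) → a ∈ I := by
    intro a ha
    refine (hprime a b fun n => ?_).resolve_right hb
    have := hI _ ((hpb _).1 (ha (-n))) n
    rwa [map_mul, ← AlgEquiv.mul_apply, ← zpow_add, add_neg_cancel, zpow_zero] at this
  obtain ⟨o, ho⟩ := exists_ker_torusEval_le hI hne hIp
  have horb : orbitIdeal o ≤ I := fun a ha => hinter a fun n => ho (mem_orbitIdeal.1 ha n)
  have hfin : (Set.range fun n => torusAct n o).Finite := by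
    refine (finite_setOf_ker_torusEval_le hI hne).subset ?_
    rintro _ ⟨n, rfl⟩
    exact ⟨_, hpp.comap _, fun a ha => hIp (hI a ha n), ker_torusEval_torusAct_le_comap ho n⟩
  refine ⟨o, le_antisymm (fun f hf => ?_) horb, hfin⟩
  -- The period of the orbit
  obtain ⟨N, hN, hper⟩ : ∃ N : ℤ, N ≠ 0 ∧ ∀ v, torusChar o (Multiplicative.ofAdd ((expAut ^ N) v)) =
      torusChar o (Multiplicative.ofAdd v) := by
    have : ¬ Function.Injective fun n => torusAct n o := fun h =>
      Set.infinite_range_of_injective h hfin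
    simp only [Function.Injective, not_forall] at this
    obtain ⟨i, j, hij, hne⟩ := this
    refine ⟨i - j, sub_ne_zero.2 hne, fun v => ?_⟩
    have h1 := torusChar_torusAct i o ((expAut ^ (-j)) v)
    have h2 := torusChar_torusAct j o ((expAut ^ (-j)) v)
    rw [hij, h2, ← LinearEquiv.mul_apply, ← LinearEquiv.mul_apply, ← zpow_add, ← zpow_add,
      add_neg_cancel, zpow_zero] at h1
    exact h1.symm
  have hzero : ∀ g ∈ I, torusEval o g = 0 := by
    intro g hg
    obtain ⟨s, v, hv, rfl⟩ := exists_sum_uHomogeneous g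
    have hcomp := Submodule.mem_of_sum_mem_of_eigenvalues (I.restrictScalars Qbar)
      (sigma ^ N : Laurent3 ≃ₐ[Qbar] Laurent3).toLinearMap (fun w hw => hI w hw N) s
      (fun c => (2 : Qbar) ^ (N * c)) (fun c _ d _ h => ?_) v (fun c _ => ?_) hg
    · rw [map_sum]
      refine Finset.sum_eq_zero fun c hc => ?_
      -- A homogeneous element of `p` is a multiple of a power of `u` modulo `p`.
      have hvp : v c ∈ p := hIp (hcomp c hc)
      obtain ⟨r, hr⟩ : ∃ r, torusEval o (v c) = AddMonoidAlgebra.single c r := by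
        refine ⟨∑ w ∈ (v c).coeff.support, (v c).coeff w * torusChar o (Multiplicative.ofAdd w), ?_⟩
        conv_lhs => rw [← AddMonoidAlgebra.sum_coeff_single (v c), Finsupp.sum, map_sum]
        refine Eq.trans ?_ (map_sum (AddMonoidAlgebra.lsingle (S := Qbar) (R := Qbar) c) _ _).symm
        refine Finset.sum_congr rfl fun w hw => ?_
        rw [torusEval_single, hv c w (Finsupp.mem_support_iff.1 hw)]
        rfl
      have h1 : AddMonoidAlgebra.single (0, 0, c) r ∈ p := by
        have h2 : v c - AddMonoidAlgebra.single (0, 0, c) r ∈ p := ho (by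
          rw [RingHom.mem_ker, map_sub, hr, torusEval_single, torusChar_ofAdd]
          simp)
        simpa using p.sub_mem hvp h2
      rw [single_eq_smul_monomial, Algebra.smul_def] at h1
      by_cases hr0 : r = 0
      · rw [hr, hr0, AddMonoidAlgebra.single_zero]
      · refine absurd (Ideal.eq_top_of_isUnit_mem _ h1 (IsUnit.mul ?_ ?_)) hpp.ne_top
        · exact IsUnit.map _ (isUnit_iff_ne_zero.2 hr0)
        · exact (monomialUnit (Multiplicative.ofAdd (0, 0, c))).isUnit
    · exact mul_left_cancel₀ hN (two_zpow_injective h)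
    · refine horb (mem_orbitIdeal.2 fun n => ?_)
      change torusEval o ((sigma ^ n) ((sigma ^ N) (v c) - (2 : Qbar) ^ (N * c) • v c)) = 0
      rw [map_sub, map_sub, map_smul, map_smul, sub_eq_zero, ← AlgEquiv.mul_apply]
      conv_lhs => rw [← AddMonoidAlgebra.sum_coeff_single (v c), Finsupp.sum, map_sum, map_sum]
      conv_rhs => rw [← AddMonoidAlgebra.sum_coeff_single (v c), Finsupp.sum, map_sum, map_sum]
      rw [Finset.smul_sum]
      refine Finset.sum_congr rfl fun w hw => ?_
      rw [← zpow_add, add_comm n N, sigma_zpow_single, sigma_zpow_single, torusEval_single,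
        torusEval_single, zpow_add expAut, LinearEquiv.mul_apply, hper, expAut_zpow_snd_snd,
        expAut_zpow_snd_snd, hv c w (Finsupp.mem_support_iff.1 hw),
        AddMonoidAlgebra.smul_single, add_mul, zpow_add₀ two_ne_zero]
      congr 1
      rw [smul_eq_mul]
      ring
  exact mem_orbitIdeal.2 fun n => hzero _ (hI f hf n)

/-! ### The prime spectrum of the example -/

open SkewLaurent

theorem hasUnitEigenvector_sigma : HasUnitEigenvector sigma := by
  refine ⟨monomialUnit (Multiplicative.ofAdd (0, 0, 1)), Units.mk0 2 two_ne_zero, fun n hn => ?_,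
    fun n => ?_⟩
  · refine two_zpow_injective ?_
    have := congrArg Units.val hn
    simpa using this
  · rw [monomialUnit_ofAdd, sigma_zpow_single, expAut_zpow_u, single_eq_smul_monomial]
    simp [Units.smul_def]

/-- The prime ideal of `S` attached to a point of the torus. -/
def orbitPrime (o : Torus2) : NCSpec SkewExample where
  asIdeal := extend (orbitIdeal o) sigma_zpow_mem_orbitIdeal
  isPrime := isPrimeTwoSided_extend _ _ hasUnitEigenvector_sigma (orbitIdeal_ne_top o)
    mem_or_mem_orbitIdeal

theorem contract_orbitPrime (o : Torus2) : contract (orbitPrime o).asIdeal = orbitIdeal o :=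
  contract_extend _ sigma_zpow_mem_orbitIdeal

theorem contract_ne_bot {P : Ideal SkewExample} [P.IsTwoSided] (h : P ≠ ⊥) : contract P ≠ ⊥ := by
  intro hc
  refine h ((Submodule.eq_bot_iff _).2 fun f hf => SkewLaurent.ext fun n => ?_)
  have := (mem_iff_coeff_mem_contract hasUnitEigenvector_sigma).1 hf n
  rwa [hc] at this

theorem exists_eq_orbitPrime (P : NCSpec SkewExample) (hP : P.asIdeal ≠ ⊥) :
    ∃ o, P = orbitPrime o ∧ (Set.range fun n => torusAct n o).Finite := by
  obtain ⟨o, ho, hfin⟩ := exists_eq_orbitIdeal (I := contract P.asIdeal)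
    (fun a ha n => zpow_mem_contract ha n) (contract_ne_bot hP)
    (fun h => P.isPrime.ne_top ((Ideal.eq_top_iff_one _).2 (by
      have h1 : (1 : Laurent3) ∈ contract P.asIdeal := h ▸ Submodule.mem_top
      rwa [mem_contract, map_one] at h1)))
    (fun a b h => mem_contract_or_mem_contract P.isPrime h)
  refine ⟨o, NCSpec.ext (eq_of_contract_eq hasUnitEigenvector_sigma ?_), hfin⟩
  rw [contract_orbitPrime, ho]

/-- Nonzero primes are maximal among primes. -/
theorem eq_of_le_of_ne_bot {P Q : NCSpec SkewExample} (hP : P.asIdeal ≠ ⊥)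
    (hPQ : P.asIdeal ≤ Q.asIdeal) : P = Q := by
  have hQ : Q.asIdeal ≠ ⊥ := fun h => hP (le_bot_iff.1 (h ▸ hPQ))
  obtain ⟨o, rfl, hfin⟩ := exists_eq_orbitPrime P hP
  obtain ⟨o', rfl, -⟩ := exists_eq_orbitPrime Q hQ
  have hle : orbitIdeal o ≤ orbitIdeal o' := by
    rw [← contract_orbitPrime, ← contract_orbitPrime]
    exact fun a ha => hPQ ha
  have hinf : hfin.toFinset.inf (fun x => RingHom.ker (torusEval x)) ≤ orbitIdeal o := by
    intro f hf
    rw [Submodule.mem_finsetInf] at hf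
    refine mem_orbitIdeal.2 fun n => torusEval_sigma_zpow_eq_zero ?_
    exact hf _ (hfin.mem_toFinset.2 ⟨n, rfl⟩)
  have hp := ker_torusEval_isPrime o'
  obtain ⟨x, hx, hxo'⟩ := (Ideal.IsPrime.inf_le' hp).1 ((hinf.trans hle).trans (orbitIdeal_le_ker o'))
  obtain ⟨n, rfl⟩ := hfin.mem_toFinset.1 hx
  obtain rfl := eq_of_ker_torusEval_le hp.ne_top hxo' le_rfl
  refine NCSpec.ext (eq_of_contract_eq hasUnitEigenvector_sigma ?_)
  rw [contract_orbitPrime, contract_orbitPrime]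
  exact le_antisymm hle (orbitIdeal_torusAct_le n o)

theorem exists_forall_eq_orbitPrime : ∃ F : NCSpec SkewExample → Torus2,
    ∀ P, P.asIdeal ≠ ⊥ → P = orbitPrime (F P) := by
  have hex : ∀ P : NCSpec SkewExample, ∃ o, P.asIdeal ≠ ⊥ → P = orbitPrime o := fun P => by
    by_cases h : P.asIdeal = ⊥
    · exact ⟨1, fun h' => absurd h h'⟩
    · obtain ⟨o, ho, -⟩ := exists_eq_orbitPrime P h
      exact ⟨o, fun _ => ho⟩
  exact ⟨_, fun P => (hex P).choose_spec⟩

/-- A nonzero element of `S` belongs to finitely many primes. -/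
theorem finite_setOf_mem_asIdeal {f : SkewExample} (hf : f ≠ 0) :
    {P : NCSpec SkewExample | f ∈ P.asIdeal}.Finite := by
  obtain ⟨F, hF⟩ := exists_forall_eq_orbitPrime
  have hbot : ∀ P : NCSpec SkewExample, f ∈ P.asIdeal → P.asIdeal ≠ ⊥ := fun P hP h =>
    hf (by rwa [h, Submodule.mem_bot] at hP)
  let I : Ideal Laurent3 := ⨅ P ∈ {P : NCSpec SkewExample | f ∈ P.asIdeal}, contract P.asIdeal
  have hmem : ∀ a, a ∈ I ↔ ∀ P : NCSpec SkewExample, f ∈ P.asIdeal → a ∈ contract P.asIdeal := by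
    intro a
    simp only [I, Submodule.mem_iInf]
    rfl
  have hI : ∀ a ∈ I, ∀ n : ℤ, (sigma ^ n) a ∈ I := fun a ha n =>
    (hmem _).2 fun P hP => zpow_mem_contract ((hmem a).1 ha P hP) n
  have hne : I ≠ ⊥ := by
    intro h
    refine hf (SkewLaurent.ext fun n => ?_)
    have : f.coeff n ∈ I := (hmem _).2 fun P hP =>
      (mem_iff_coeff_mem_contract hasUnitEigenvector_sigma).1 hP n
    rwa [h, Submodule.mem_bot] at this
  refine Set.Finite.of_injOn (f := F) (fun P hP => ?_) (fun P hP Q hQ h => ?_)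
    (finite_setOf_ker_torusEval_le hI hne)
  · refine ⟨_, ker_torusEval_isPrime (F P), fun a ha => orbitIdeal_le_ker _ ?_, le_rfl⟩
    rw [← contract_orbitPrime, ← hF P (hbot P hP)]
    exact (hmem a).1 ha P hP
  · rw [hF P (hbot P hP), hF Q (hbot Q hQ), h]

instance : Countable Qbar := by
  rw [← Cardinal.mk_le_aleph0_iff]
  have : Algebra.IsAlgebraic ℚ Qbar := AlgebraicClosure.isAlgebraic ℚ
  exact (Algebra.IsAlgebraic.cardinalMk_le_max ℚ Qbar).trans (by simp)

theorem countable_ncSpec : Countable (NCSpec SkewExample) := by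
  obtain ⟨F, hF⟩ := exists_forall_eq_orbitPrime
  have : Countable Qbarˣ := Units.val_injective.countable
  refine Function.Injective.countable (f := fun P : NCSpec SkewExample =>
    (F P, P.asIdeal = ⊥)) fun P Q h => ?_
  simp only [Prod.mk.injEq, eq_iff_iff] at h
  by_cases hP : P.asIdeal = ⊥
  · exact NCSpec.ext (hP.trans (h.2.1 hP).symm)
  · rw [hF P hP, hF Q fun hQ => hP (h.2.2 hQ), h.1]

/-- The orbits of points of finite order are finite, so that the corresponding primes are
nonzero. -/
theorem orbitPrime_ne_bot {o : Torus2} {l : ℕ} (hl : l ≠ 0) (ho : o ^ l = 1) :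
    (orbitPrime o).asIdeal ≠ ⊥ := by
  intro h
  have h1 : AddMonoidAlgebra.single ((l : ℤ), 0, 0) 1 - 1 ∈ orbitIdeal o := by
    refine mem_orbitIdeal.2 fun n => ?_
    have hv : (expAut ^ n) ((l : ℤ), 0, 0) = (l : ℤ) • (expAut ^ n) (1, 0, 0) := by
      rw [← map_zsmul]; simp
    have h2 : ∀ v, torusChar o v ^ l = 1 := fun v => by
      have h3 : o.1 ^ l = 1 := congrArg Prod.fst ho
      have h4 : o.2 ^ l = 1 := congrArg Prod.snd ho
      change (o.1 ^ v.toAdd.1 * o.2 ^ v.toAdd.2.1) ^ l = 1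
      rw [mul_pow, ← zpow_natCast, ← zpow_natCast, zpow_comm, zpow_comm o.2, zpow_natCast,
        zpow_natCast, h3, h4, one_zpow, one_zpow, one_mul]
    rw [map_sub, map_sub, map_one, map_one, sigma_zpow_single, torusEval_single,
      expAut_zpow_snd_snd, hv, ofAdd_zsmul, map_zpow (torusChar o), zpow_natCast, h2]
    rw [one_mul, mul_zero, zpow_zero, Units.val_one, one_mul]
    exact sub_self (1 : AddMonoidAlgebra Qbar ℤ)
  rw [← contract_orbitPrime, h, mem_contract, Submodule.mem_bot] at h1
  have h2 := monomial_injective 0 (h1.trans (monomial_zero_right (σ := sigma) 0).symm)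
  rw [sub_eq_zero, AddMonoidAlgebra.one_def] at h2
  have h3 := AddMonoidAlgebra.single_left_injective one_ne_zero h2
  simp [hl] at h3

theorem infinite_ncSpec : Infinite (NCSpec SkewExample) := by
  by_contra hfin
  rw [not_infinite_iff_finite] at hfin
  have hex : ∀ n : ℕ, ∃ ζ : Qbar, IsPrimitiveRoot ζ (n + 1) := fun n =>
    HasEnoughRootsOfUnity.exists_primitiveRoot Qbar (n + 1)
  choose ζ hζ using hex
  let g : ℕ → Torus2 := fun n => ((hζ n).isUnit (Nat.succ_ne_zero n) |>.unit, 1)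
  have hg : Function.Injective g := fun m n h => by
    have h1 : ζ m = ζ n := congrArg (fun o : Torus2 => (o.1 : Qbar)) h
    have h2 := (hζ m).eq_orderOf
    have h3 := (hζ n).eq_orderOf
    rw [h1] at h2
    omega
  have hbot : ∀ n, (orbitPrime (g n)).asIdeal ≠ ⊥ := fun n =>
    orbitPrime_ne_bot (Nat.succ_ne_zero n) (Prod.ext (Units.ext (hζ n).pow_eq_one) (one_pow _))
  -- A nonzero prime lies under finitely many points only.
  obtain ⟨P, hP⟩ := Finite.exists_infinite_fiber fun n => orbitPrime (g n)
  have hP' : P.asIdeal ≠ ⊥ := by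
    obtain ⟨n, hn⟩ := hP.nonempty
    rw [← (show orbitPrime (g n) = P from hn)]
    exact hbot n
  have h1 := finite_setOf_ker_torusEval_le (I := contract P.asIdeal)
    (fun a ha n => zpow_mem_contract ha n) (contract_ne_bot hP')
  refine Set.infinite_coe_iff.1 hP (Set.Finite.of_injOn (f := g) (fun n hn => ?_) hg.injOn h1)
  refine ⟨_, ker_torusEval_isPrime (g n), ?_, le_rfl⟩
  rw [← (show orbitPrime (g n) = P from hn), contract_orbitPrime]
  exact orbitIdeal_le_ker _

end

noncomputable section

/-! ### Spectra with finite proper closed sets -/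

/-- Two countably infinite spaces, whose closed sets are the whole space and the finite sets that
avoid a given point, are homeomorphic. -/
theorem nonempty_homeomorph_of_isClosed_iff {X Y : Type*} [TopologicalSpace X] [TopologicalSpace Y]
    [Countable X] [Countable Y] [Infinite X] [Infinite Y] (x₀ : X) (y₀ : Y)
    (hX : ∀ Z : Set X, IsClosed Z ↔ Z = Set.univ ∨ (Z.Finite ∧ x₀ ∉ Z))
    (hY : ∀ Z : Set Y, IsClosed Z ↔ Z = Set.univ ∨ (Z.Finite ∧ y₀ ∉ Z)) : Nonempty (X ≃ₜ Y) := by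
  classical
  obtain ⟨e₀⟩ := nonempty_equiv_of_countable (α := X) (β := Y)
  let e : X ≃ Y := e₀.trans (Equiv.swap (e₀ x₀) y₀)
  have he : e x₀ = y₀ := by simp [e]
  refine ⟨e.toHomeomorphOfContinuousClosed (continuous_iff_isClosed.2 fun Z hZ => ?_)
    fun Z hZ => ?_⟩
  · rw [hX]
    rcases (hY Z).1 hZ with rfl | ⟨hfin, hy⟩
    · exact Or.inl rfl
    · exact Or.inr ⟨hfin.preimage e.injective.injOn, by rwa [Set.mem_preimage, he]⟩
  · rw [hY]
    rcases (hX Z).1 hZ with rfl | ⟨hfin, hx⟩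
    · exact Or.inl (by rw [Set.image_univ, e.range_eq_univ])
    · refine Or.inr ⟨hfin.image e, ?_⟩
      rintro ⟨x, hxZ, hxy⟩
      exact hx (e.injective (hxy.trans he.symm) ▸ hxZ)

namespace NCSpec

variable {R : Type*} [Ring R]

theorem isClosed_iff {Z : Set (NCSpec R)} : IsClosed Z ↔ ∃ s : Set R, Z = zeroLocus s := by
  rw [← isOpen_compl_iff]
  change Zᶜᶜ ∈ {Z | ∃ s : Set R, Z = zeroLocus s} ↔ _
  rw [compl_compl]
  rfl

theorem mem_zeroLocus {s : Set R} {P : NCSpec R} : P ∈ zeroLocus s ↔ s ⊆ P.asIdeal := Iff.rfl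

/-- The order of the spectrum is determined by its topology. -/
theorem le_iff_forall_isClosed {P Q : NCSpec R} :
    P ≤ Q ↔ ∀ Z, IsClosed Z → P ∈ Z → Q ∈ Z := by
  refine ⟨fun h Z hZ hP => ?_, fun h => ?_⟩
  · obtain ⟨s, rfl⟩ := isClosed_iff.1 hZ
    exact Set.Subset.trans hP h
  · exact h _ (isClosed_iff.2 ⟨P.asIdeal, rfl⟩) (Set.Subset.refl (P.asIdeal : Set R))

/-- A homeomorphism of spectra is an isomorphism of partially ordered sets. -/
def orderIsoOfHomeomorph {S : Type*} [Ring S] (e : NCSpec R ≃ₜ NCSpec S) : NCSpec R ≃o NCSpec S where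
  toEquiv := e.toEquiv
  map_rel_iff' {P Q} := by
    rw [le_iff_forall_isClosed, le_iff_forall_isClosed]
    refine ⟨fun h Z hZ hP => ?_, fun h Z hZ hP => h (e ⁻¹' Z) (hZ.preimage e.continuous) hP⟩
    have := h (e.symm ⁻¹' Z) (hZ.preimage e.symm.continuous) (by simpa using hP)
    simpa using this

/-- If `{0}` is prime, nonzero primes are maximal, and a nonzero element lies in finitely many
primes, then the proper closed sets are the finite sets of nonzero primes. -/
theorem isClosed_iff_finite {P₀ : NCSpec R} (h₀ : P₀.asIdeal = ⊥)
    (hmax : ∀ P Q : NCSpec R, P.asIdeal ≠ ⊥ → P.asIdeal ≤ Q.asIdeal → P = Q)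
    (hfin : ∀ f : R, f ≠ 0 → {P : NCSpec R | f ∈ P.asIdeal}.Finite) (Z : Set (NCSpec R)) :
    IsClosed Z ↔ Z = Set.univ ∨ (Z.Finite ∧ P₀ ∉ Z) := by
  constructor
  · intro hZ
    obtain ⟨s, rfl⟩ := isClosed_iff.1 hZ
    by_cases hs : s ⊆ {0}
    · left
      refine Set.eq_univ_of_forall fun P => mem_zeroLocus.2 fun x hx => ?_
      rw [Set.mem_singleton_iff.1 (hs hx)]
      exact P.asIdeal.zero_mem
    · obtain ⟨f, hf, hf0⟩ := Set.not_subset.1 hs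
      refine Or.inr ⟨(hfin f hf0).subset fun P hP => hP hf, fun h => hf0 ?_⟩
      have : f ∈ P₀.asIdeal := h hf
      rwa [h₀, Submodule.mem_bot] at this
  · rintro (rfl | ⟨hZ, hP₀⟩)
    · exact isClosed_univ
    · rw [← Set.biUnion_of_singleton Z]
      refine hZ.isClosed_biUnion fun P hP => isClosed_iff.2 ⟨P.asIdeal, ?_⟩
      have hne : P.asIdeal ≠ ⊥ := fun h => hP₀ (NCSpec.ext (h₀.trans h.symm) ▸ hP)
      ext Q
      rw [mem_zeroLocus]
      exact ⟨fun h => by rw [Set.mem_singleton_iff.1 h], fun h => (hmax P Q hne h).symm⟩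

/-- In this situation the zero ideal is not locally closed when there are infinitely many
primes. -/
theorem not_locallyClosed_of_isClosed_iff_finite [Infinite (NCSpec R)] {P₀ : NCSpec R}
    (h : ∀ Z : Set (NCSpec R), IsClosed Z ↔ Z = Set.univ ∨ (Z.Finite ∧ P₀ ∉ Z)) :
    ¬ P₀.LocallyClosed := by
  rintro ⟨U, Z, hU, hZ, hUZ⟩
  have hP : P₀ ∈ U ∩ Z := hUZ ▸ Set.mem_singleton P₀
  have hZ' : Z = Set.univ := ((h Z).1 hZ).resolve_right fun h' => h'.2 hP.2
  rw [hZ', Set.inter_univ] at hUZ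
  rcases (h Uᶜ).1 hU.isClosed_compl with h' | ⟨h', -⟩
  · exact absurd hP.1 (by rw [← Set.mem_compl_iff, h']; trivial)
  · rw [← hUZ] at h'
    exact Set.infinite_univ (((Set.finite_singleton P₀).union h').subset
      fun x _ => (Set.mem_union _ _ _).2 (em _))

end NCSpec

/-! ### Commutative rings -/

namespace NCSpec

variable {R : Type*} [CommRing R]

theorem isPrimeTwoSided_iff {P : Ideal R} : IsPrimeTwoSided P ↔ P.IsPrime := by
  constructor
  · intro h
    refine ⟨h.ne_top, fun {a b} hab => h.mem_or_mem a b fun r => ?_⟩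
    rw [mul_right_comm]
    exact P.mul_mem_right _ hab
  · intro h
    refine ⟨inferInstance, h.ne_top, fun a b hab => h.mem_or_mem ?_⟩
    simpa using hab 1

/-- For a commutative ring the two notions of prime spectrum agree. -/
def homeomorphPrimeSpectrum : NCSpec R ≃ₜ PrimeSpectrum R :=
  let e : NCSpec R ≃ PrimeSpectrum R :=
    { toFun := fun P => ⟨P.asIdeal, isPrimeTwoSided_iff.1 P.isPrime⟩
      invFun := fun P => ⟨P.asIdeal, isPrimeTwoSided_iff.2 P.isPrime⟩
      left_inv := fun _ => rfl
      right_inv := fun _ => rfl }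
  e.toHomeomorphOfContinuousClosed
    (continuous_iff_isClosed.2 fun Z hZ => by
      obtain ⟨s, rfl⟩ := (PrimeSpectrum.isClosed_iff_zeroLocus Z).1 hZ
      exact isClosed_iff.2 ⟨s, rfl⟩)
    (fun Z hZ => by
      obtain ⟨s, rfl⟩ := isClosed_iff.1 hZ
      refine (PrimeSpectrum.isClosed_iff_zeroLocus _).2 ⟨s, ?_⟩
      rw [e.image_eq_preimage_symm]
      rfl)

end NCSpec

/-! ### The polynomial ring in one variable -/

section Polynomial

open Polynomial NCSpec OreLocalization

variable (k : Type u) [Field k]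

theorem isMaximal_of_ne_bot {P : NCSpec k[X]} (hP : P.asIdeal ≠ ⊥) : P.asIdeal.IsMaximal :=
  have := isPrimeTwoSided_iff.1 P.isPrime
  IsPrime.to_maximal_ideal hP

theorem finite_setOf_mem_asIdeal_polynomial {f : k[X]} (hf : f ≠ 0) :
    {P : NCSpec k[X] | f ∈ P.asIdeal}.Finite := by
  refine Set.Finite.of_injOn (f := NCSpec.asIdeal) (t := (Ideal.span {f}).minimalPrimes)
    (fun P hP => ?_) (fun P _ Q _ h => NCSpec.ext h)
    (Ideal.finite_minimalPrimes_of_isNoetherianRing _ _)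
  have hPp := isPrimeTwoSided_iff.1 P.isPrime
  refine ⟨⟨hPp, (Ideal.span_singleton_le_iff_mem _).2 hP⟩, fun q hq hqP => ?_⟩
  have hq' : q.IsPrime := hq.1
  have hqne : q ≠ ⊥ := fun h => hf (by
    have := (Ideal.span_singleton_le_iff_mem _).1 hq.2
    rwa [h, Submodule.mem_bot] at this)
  exact ((IsPrime.to_maximal_ideal hqne).eq_of_le hPp.ne_top hqP).ge

/-- The zero ideal of `k[t]`. -/
def polynomialBot : NCSpec k[X] := ⟨⊥, isPrimeTwoSided_iff.2 Ideal.isPrime_bot⟩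

theorem isClosed_iff_finite_polynomial (Z : Set (NCSpec k[X])) :
    IsClosed Z ↔ Z = Set.univ ∨ (Z.Finite ∧ polynomialBot k ∉ Z) :=
  isClosed_iff_finite rfl
    (fun _ Q hP hPQ => NCSpec.ext ((isMaximal_of_ne_bot k hP).eq_of_le Q.isPrime.ne_top hPQ))
    (fun _ hf => finite_setOf_mem_asIdeal_polynomial k hf) Z

instance [Infinite k] : Infinite (NCSpec k[X]) := by
  refine Infinite.of_injective (fun a : k => (⟨Ideal.span {X - C a}, isPrimeTwoSided_iff.2
    ((Ideal.span_singleton_prime (X_sub_C_ne_zero a)).2 (prime_X_sub_C a))⟩ : NCSpec k[X]))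
    fun a b h => ?_
  have h1 : Ideal.span {X - C a} = Ideal.span {X - C b} := congrArg NCSpec.asIdeal h
  have h2 : X - C a ∣ X - C b := by
    rw [← Ideal.mem_span_singleton, h1]; exact Ideal.mem_span_singleton_self _
  have h3 := dvd_iff_isRoot.1 h2
  simpa [sub_eq_zero] using h3

instance [Countable k] : Countable (NCSpec k[X]) := by
  have : Countable k[X] := by
    rw [← Cardinal.mk_le_aleph0_iff]
    exact cardinalMk_le_max.trans (by simp)
  refine Function.Injective.countable (f := fun P : NCSpec k[X] =>
    Submodule.IsPrincipal.generator P.asIdeal) fun P Q h => NCSpec.ext ?_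
  rw [← Ideal.span_singleton_generator P.asIdeal, ← Ideal.span_singleton_generator Q.asIdeal]
  exact congrArg (fun f => Ideal.span {f}) h

/-- The annihilator of a simple module over a commutative ring is maximal. -/
theorem isMaximal_of_isPrimitive {R : Type u} [CommRing R] {P : NCSpec R} (h : P.IsPrimitive) :
    P.asIdeal.IsMaximal := by
  obtain ⟨M, _, _, hM, hann⟩ := h
  rw [← hann]
  exact IsSimpleModule.annihilator_isMaximal

theorem isPrimitive_of_isMaximal {R : Type u} [CommRing R] {P : NCSpec R} (h : P.asIdeal.IsMaximal) :
    P.IsPrimitive :=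
  ⟨R ⧸ P.asIdeal, inferInstance, inferInstance,
    isSimpleModule_iff_isCoatom.2 (Ideal.isMaximal_def.1 h), Ideal.annihilator_quotient⟩

/-- Zariski's lemma, for the polynomial ring in one variable. -/
theorem finite_quotient_of_isMaximal {P : Ideal k[X]} (hP : P.IsMaximal) :
    Module.Finite k (k[X] ⧸ P) :=
  letI := Ideal.Quotient.field P
  finite_of_finite_type_of_isJacobsonRing k (k[X] ⧸ P)

/-- The fraction field of an algebraic `k`-domain is algebraic over `k`. -/
theorem isAlgebraic_oreLocalization {R : Type*} [CommRing R] [IsDomain R] [Algebra k R]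
    [Algebra.IsAlgebraic k R] [OreSet (nonZeroDivisors R)]
    (c : OreLocalization (nonZeroDivisors R) R) : IsAlgebraic k c := by
  let f : R →ₐ[k] OreLocalization (nonZeroDivisors R) R :=
    { numeratorRingHom with commutes' := fun _ => rfl }
  have hnum : ∀ r, IsAlgebraic k (f r) := fun r =>
    (Algebra.IsAlgebraic.isAlgebraic (R := k) r).algHom f
  induction c using OreLocalization.ind with
  | _ r s =>
    have hs : f s ≠ 0 := (numerator_isUnit s).ne_zero
    have h : f s * (r /ₒ s) = f r := OreLocalization.mul_cancel
    have h' : r /ₒ s = (f s)⁻¹ * f r := by rw [← h, inv_mul_cancel_left₀ hs]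
    rw [h']
    exact (hnum s).inv.mul (hnum r)

theorem isRational_of_ne_bot {P : NCSpec k[X]} (hP : P.asIdeal ≠ ⊥) : P.IsRational k := by
  have hmax := isMaximal_of_ne_bot k hP
  have hprime : P.asIdeal.IsPrime := hmax.isPrime
  have := finite_quotient_of_isMaximal k hmax
  exact ⟨oreSetComm _, fun c _ =>
    letI : OreSet (nonZeroDivisors (k[X] ⧸ P.asIdeal)) := oreSetComm _
    isAlgebraic_oreLocalization k c⟩

theorem not_isRational_polynomialBot : ¬ (polynomialBot k).IsRational k := by
  rintro ⟨_, h⟩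
  have := isPrimeTwoSided_iff.1 (polynomialBot k).isPrime
  let f : (k[X] ⧸ (polynomialBot k).asIdeal) →ₐ[k] OreLocalization
      (nonZeroDivisors (k[X] ⧸ (polynomialBot k).asIdeal)) (k[X] ⧸ (polynomialBot k).asIdeal) :=
    { OreLocalization.numeratorRingHom with commutes' := fun _ => rfl }
  have hf : Function.Injective f := OreLocalization.numeratorHom_inj fun x hx => hx.1
  let π : k[X] →ₐ[k] (k[X] ⧸ (polynomialBot k).asIdeal) := Ideal.Quotient.mkₐ k _
  have hπ : Function.Injective π := fun x y hxy => by
    have : x - y ∈ (⊥ : Ideal k[X]) := Ideal.Quotient.eq.1 hxy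
    exact sub_eq_zero.1 this
  have hX : IsAlgebraic k (f (π X)) := h _ (Subalgebra.mem_center_iff.2 fun b => mul_comm b _)
  rw [isAlgebraic_algHom_iff f hf, isAlgebraic_algHom_iff π hπ] at hX
  exact transcendental_X k hX

/-- The Dixmier–Moeglin equivalence holds for `k[t]`. -/
theorem dixmierMoeglin_polynomial [Infinite k] : DixmierMoeglin k k[X] := by
  intro P
  have hP : P.asIdeal = ⊥ → P = polynomialBot k := fun h => NCSpec.ext h
  have h1 : P.LocallyClosed ↔ P.asIdeal ≠ ⊥ := by
    refine ⟨fun h hb => ?_, fun h => ?_⟩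
    · rw [hP hb] at h
      exact not_locallyClosed_of_isClosed_iff_finite (isClosed_iff_finite_polynomial k) h
    · refine IsClosed.isLocallyClosed ((isClosed_iff_finite_polynomial k _).2
        (Or.inr ⟨Set.finite_singleton P, fun hb => h ?_⟩))
      rw [← Set.mem_singleton_iff.1 hb]; rfl
  have h2 : P.IsPrimitive ↔ P.asIdeal ≠ ⊥ := by
    refine ⟨fun h hb => ?_, fun h => isPrimitive_of_isMaximal (isMaximal_of_ne_bot k h)⟩
    have := isMaximal_of_isPrimitive h
    rw [hb] at this
    exact Polynomial.not_isField k (Ring.isField_iff_maximal_bot.2 this)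
  have h3 : P.IsRational k ↔ P.asIdeal ≠ ⊥ := by
    refine ⟨fun h hb => ?_, isRational_of_ne_bot k⟩
    rw [hP hb] at h
    exact not_isRational_polynomialBot k h
  rw [h1, h2, h3]
  exact ⟨Iff.rfl, Iff.rfl⟩

end Polynomial

end

noncomputable section

/-! ### Rationality of the zero ideal -/

section Rational

open OreLocalization

/-- A central element of the quotient division ring of a noetherian domain `R` acts by
multiplication as a bimodule homomorphism `φ` from a nonzero two-sided ideal to `R`. If every such
`φ` agrees with a scalar at some nonzero element, then the centre consists of scalars. -/
theorem NCSpec.isRational_of_bimodule_hom {k R : Type*} [Field k] [Ring R] [Algebra k R]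
    [IsDomain R] [IsNoetherianRing R] {P : NCSpec R} (hP : P.asIdeal = ⊥)
    (H : ∀ (D : Ideal R) (φ : R → R), D.IsTwoSided → D ≠ ⊥ →
      (∀ t ∈ D, ∀ s, φ (s * t) = s * φ t ∧ φ (t * s) = φ t * s) →
      ∃ t ∈ D, t ≠ 0 ∧ ∃ κ : k, φ t = κ • t) : P.IsRational k := by
  obtain ⟨P, hPp⟩ := P
  obtain rfl : P = ⊥ := hP
  have := hPp.isTwoSided
  have hinj : Function.Injective (Ideal.Quotient.mk (⊥ : Ideal R)) := fun x y hxy =>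
    sub_eq_zero.1 (Ideal.Quotient.eq.1 hxy : x - y ∈ (⊥ : Ideal R))
  let e : R ≃+* R ⧸ (⊥ : Ideal R) :=
    RingEquiv.ofBijective _ ⟨hinj, Ideal.Quotient.mk_surjective⟩
  have : IsDomain (R ⧸ (⊥ : Ideal R)) := e.symm.toMulEquiv.isDomain R
  have : IsNoetherianRing (R ⧸ (⊥ : Ideal R)) := isNoetherianRing_of_ringEquiv R e
  obtain ⟨hO⟩ := nonempty_oreSet_of_strongRankCondition (R := R ⧸ (⊥ : Ideal R))
  refine ⟨hO, fun c hc => ?_⟩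
  change IsAlgebraic k (c : OreLocalization (nonZeroDivisors (R ⧸ (⊥ : Ideal R)))
    (R ⧸ (⊥ : Ideal R)))
  let ι : R →ₐ[k] OreLocalization (nonZeroDivisors (R ⧸ (⊥ : Ideal R))) (R ⧸ (⊥ : Ideal R)) :=
    { (numeratorRingHom (S := nonZeroDivisors (R ⧸ (⊥ : Ideal R)))).comp
        (Ideal.Quotient.mk (⊥ : Ideal R)) with commutes' := fun _ => rfl }
  have hι : Function.Injective ι :=
    (numeratorHom_inj (S := nonZeroDivisors (R ⧸ (⊥ : Ideal R))) inf_le_left).comp hinj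
  have hc' : ∀ b, b * c = c * b := fun b => Subalgebra.mem_center_iff.1 hc b
  let D : Ideal R :=
    { carrier := {t | ∃ r, ι t * c = ι r}
      zero_mem' := ⟨0, by simp⟩
      add_mem' := by
        rintro t t' ⟨r, hr⟩ ⟨r', hr'⟩
        exact ⟨r + r', by rw [map_add, add_mul, hr, hr', map_add]⟩
      smul_mem' := by
        rintro s t ⟨r, hr⟩
        exact ⟨s * r, by rw [smul_eq_mul, map_mul, mul_assoc, hr, map_mul]⟩ }
  have hDt : D.IsTwoSided := ⟨by
    rintro t s ⟨r, hr⟩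
    exact ⟨r * s, by rw [map_mul, mul_assoc, hc', ← mul_assoc, hr, map_mul]⟩⟩
  have hD : D ≠ ⊥ := by
    induction c using OreLocalization.ind with
    | _ r s =>
      obtain ⟨s₀, hs₀⟩ := Ideal.Quotient.mk_surjective (s : R ⧸ (⊥ : Ideal R))
      obtain ⟨r₀, hr₀⟩ := Ideal.Quotient.mk_surjective r
      have hmem : s₀ ∈ D := ⟨r₀, by
        change numeratorRingHom (Ideal.Quotient.mk ⊥ s₀) * (r /ₒ s) =
          numeratorRingHom (Ideal.Quotient.mk ⊥ r₀)
        rw [hs₀, hr₀]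
        exact OreLocalization.mul_cancel⟩
      intro hbot
      rw [hbot, Submodule.mem_bot] at hmem
      refine nonZeroDivisors.ne_zero s.2 ?_
      rw [← hs₀, hmem, map_zero]
  choose! φ hφ using fun t (ht : t ∈ D) => ht
  obtain ⟨t, ht, ht0, κ, hκ⟩ := H D φ hDt hD fun t ht s =>
    ⟨hι (by rw [← hφ _ (D.mul_mem_left s ht), map_mul, mul_assoc, hφ t ht, map_mul]),
      hι (by rw [← hφ _ (hDt.mul_mem_of_left s ht), map_mul, mul_assoc, hc', ← mul_assoc,
        hφ t ht, map_mul])⟩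
  have h1 : ι t * c = ι t * algebraMap k _ κ := by
    rw [hφ t ht, hκ, map_smul, Algebra.smul_def, Algebra.commutes]
  have h2 : ι t ≠ 0 := fun h => ht0 (hι (h.trans (map_zero ι).symm))
  rw [mul_left_cancel₀ h2 h1]
  exact isAlgebraic_algebraMap κ

end Rational

open SkewLaurent in
/-- A bimodule homomorphism from a nonzero ideal `D` to the skew Laurent ring sends a nonzero
`a ∈ D` from the Laurent polynomial ring to an element commuting with `u`, hence to a Laurent
polynomial `r`; commutation with `z` gives `a * sigma r = sigma a * r`, so `r` is a multiple
of `a`. -/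
theorem exists_bimodule_hom_eq_smul {D : Ideal SkewExample} {φ : SkewExample → SkewExample}
    (hD : D.IsTwoSided) (hne : D ≠ ⊥)
    (hφ : ∀ t ∈ D, ∀ s, φ (s * t) = s * φ t ∧ φ (t * s) = φ t * s) :
    ∃ t ∈ D, t ≠ 0 ∧ ∃ κ : Qbar, φ t = κ • t := by
  obtain ⟨a, ha, ha0⟩ := Submodule.exists_mem_ne_zero_of_ne_bot (contract_ne_bot hne)
  have haD : C sigma a ∈ D := ha
  have hu : ∀ w : Laurent3, C sigma w * φ (C sigma a) = φ (C sigma a) * C sigma w := fun w => by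
    rw [← (hφ _ haD _).1, ← (hφ _ haD _).2, ← map_mul, ← map_mul, mul_comm]
  have hcoeff : ∀ n : ℤ, n ≠ 0 → (φ (C sigma a)).coeff n = 0 := fun n hn => by
    obtain ⟨u, q, hq, huq⟩ := hasUnitEigenvector_sigma
    have h1 := congrArg (fun f => SkewLaurent.coeff f n) (hu u)
    simp only [coeff_C_mul, coeff_mul_C, huq, Units.smul_def, mul_smul_comm] at h1
    rw [mul_comm, ← sub_eq_zero, ← one_smul Qbar (_ * _), smul_smul, ← sub_smul, mul_one,
      smul_eq_zero, u.isUnit.mul_left_eq_zero] at h1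
    refine h1.resolve_left fun h => hn (hq n (Units.ext ?_))
    rw [← sub_eq_zero.1 h, Units.val_one]
  have hr : φ (C sigma a) = C sigma ((φ (C sigma a)).coeff 0) := by
    refine SkewLaurent.ext fun n => ?_
    rw [C_apply (coeff _ _), coeff_monomial]
    split_ifs with h
    · rw [h]
    · exact hcoeff n (Ne.symm h)
  generalize (φ (C sigma a)).coeff 0 = r at hr
  have hz : a * sigma r = sigma a * r := by
    have h1 : C sigma a * monomial sigma 1 1 * φ (C sigma a) =
        φ (C sigma a) * (monomial sigma 1 1 * C sigma a) := by
      rw [← (hφ _ haD _).1, ← (hφ _ haD _).2, mul_assoc]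
    rw [hr, C_mul_monomial, monomial_mul_C, monomial_mul_C, C_mul_monomial] at h1
    have h2 := congrArg (fun f => SkewLaurent.coeff f 1) h1
    simpa [coeff_monomial, mul_comm] using h2
  obtain ⟨κ, hκ⟩ := exists_smul_eq_of_mul_sigma_eq ha0 hz
  refine ⟨C sigma a, haD, fun h => ha0 ?_, κ, by rw [hr, hκ, map_smul]⟩
  simpa [C_apply, coeff_monomial] using congrArg (fun f => SkewLaurent.coeff f 0) h

instance : IsDomain SkewExample := NoZeroDivisors.to_isDomain _

theorem isRational_of_eq_bot {P : NCSpec SkewExample} (hP : P.asIdeal = ⊥) : P.IsRational Qbar :=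
  NCSpec.isRational_of_bimodule_hom hP fun _ _ => exists_bimodule_hom_eq_smul

end

noncomputable section

/-! ### Generators and dimension of a skew Laurent ring -/

section

open SkewLaurent

variable {k A : Type*} [Field k] [CommRing A] [Algebra k A] (σ : A ≃ₐ[k] A)

attribute [local irreducible] SkewLaurent.instRing

theorem SkewLaurent.finiteType [Algebra.FiniteType k A] : Algebra.FiniteType k (SkewLaurent σ) := by
  obtain ⟨s, hs⟩ := Algebra.FiniteType.out (R := k) (A := A)
  classical
  refine ⟨⟨s.image (C σ) ∪ {(zUnit σ 1 : SkewLaurent σ), (↑(zUnit σ 1)⁻¹ : SkewLaurent σ)},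
    top_le_iff.1 fun f _ => ?_⟩⟩
  let t : Set (SkewLaurent σ) :=
    ↑(s.image (C σ) ∪ {(zUnit σ 1 : SkewLaurent σ), (↑(zUnit σ 1)⁻¹ : SkewLaurent σ)})
  let B := Algebra.adjoin k t
  change f ∈ B
  have hsub : C σ '' (s : Set A) ⊆ t := by
    rintro _ ⟨b, hb, rfl⟩
    exact Finset.mem_coe.2 (Finset.mem_union_left _ (Finset.mem_image_of_mem _ hb))
  have hC : ∀ a, C σ a ∈ B := fun a => by
    have h1 : C σ a ∈ (Algebra.adjoin k (s : Set A)).map (C σ) := ⟨a, by rw [hs]; trivial, rfl⟩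
    rw [AlgHom.map_adjoin] at h1
    exact Algebra.adjoin_mono hsub h1
  have hz : (zUnit σ 1 : SkewLaurent σ) ∈ B := Algebra.subset_adjoin (by simp [t])
  have hz' : (↑(zUnit σ 1)⁻¹ : SkewLaurent σ) ∈ B := Algebra.subset_adjoin (by simp [t])
  have hzn : ∀ n : ℤ, monomial σ n 1 ∈ B := fun n => by
    rcases Int.eq_nat_or_neg n with ⟨m, rfl | rfl⟩
    · have := pow_mem hz m
      rwa [zUnit_pow, mul_one] at this
    · have h : (↑(zUnit σ 1)⁻¹ : SkewLaurent σ) = (zUnit σ (-1) : SkewLaurent σ) := rfl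
      have := pow_mem hz' m
      rwa [h, zUnit_pow, mul_neg, mul_one] at this
  rw [← sum_monomial f]
  refine sum_mem fun n _ => ?_
  rw [← mul_one (f.coeff n), ← C_mul_monomial]
  exact mul_mem (hC _) (hzn n)

theorem SkewLaurent.not_finite [Nontrivial A] : ¬ Module.Finite k (SkewLaurent σ) := by
  intro h
  have hli : LinearIndependent k fun n : ℤ => monomial σ n 1 := by
    rw [linearIndependent_iff']
    intro s g hg n hn
    have := congrArg (fun f => SkewLaurent.coeff f n) hg
    simpa [coeff_sum, coeff_monomial, hn, Finset.sum_ite_eq'] using this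
  exact not_finite_iff_infinite.2 inferInstance hli.finite

end

/-! ### Failure of the Dixmier–Moeglin equivalence -/

section

theorem isPrimeTwoSided_bot {R : Type*} [Ring R] [IsDomain R] :
    IsPrimeTwoSided (⊥ : Ideal R) where
  isTwoSided := inferInstance
  ne_top := bot_ne_top
  mem_or_mem a b h := by simpa using h 1

/-- The zero ideal of the skew Laurent ring. -/
def skewBot : NCSpec SkewExample := ⟨⊥, isPrimeTwoSided_bot⟩

theorem isClosed_iff_finite_skewExample (Z : Set (NCSpec SkewExample)) :
    IsClosed Z ↔ Z = Set.univ ∨ (Z.Finite ∧ skewBot ∉ Z) :=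
  NCSpec.isClosed_iff_finite rfl (fun _ _ => eq_of_le_of_ne_bot)
    (fun _ => finite_setOf_mem_asIdeal) Z

theorem not_locallyClosed_skewBot : ¬ skewBot.LocallyClosed :=
  have := infinite_ncSpec
  NCSpec.not_locallyClosed_of_isClosed_iff_finite isClosed_iff_finite_skewExample

theorem not_dixmierMoeglin_skewExample : ¬ DixmierMoeglin Qbar SkewExample := fun h =>
  not_locallyClosed_skewBot (((h skewBot).1.trans (h skewBot).2).2 (isRational_of_eq_bot rfl))

theorem nonempty_homeomorph_polynomial :
    Nonempty (NCSpec SkewExample ≃ₜ NCSpec (Polynomial Qbar)) :=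
  have := infinite_ncSpec
  have := countable_ncSpec
  nonempty_homeomorph_of_isClosed_iff _ _ isClosed_iff_finite_skewExample
    (isClosed_iff_finite_polynomial Qbar)

end

end

theorem mainTheorem5 :
    -- the skew Laurent ring is a finitely generated, infinite-dimensional, prime, (left and right)
    -- noetherian algebra over the field of algebraic numbers
    (Algebra.FiniteType Qbar SkewExample ∧ ¬ Module.Finite Qbar SkewExample ∧
      IsPrimeRing SkewExample ∧
      IsNoetherianRing SkewExample ∧ IsNoetherianRing SkewExampleᵐᵒᵖ) ∧
    -- its spectrum is homeomorphic to that of the polynomial ring in one variable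
    Nonempty (NCSpec SkewExample ≃ₜ PrimeSpectrum (Polynomial Qbar)) ∧
    -- the zero ideal is rational but not locally closed, so the equivalence fails
    (∃ P : NCSpec SkewExample, P.asIdeal = ⊥ ∧ P.IsRational Qbar ∧ ¬ P.LocallyClosed) ∧
    ¬ DixmierMoeglin Qbar SkewExample ∧
    -- the Dixmier–Moeglin equivalence is not detected by the poset of primes over this field
    (¬ ∀ (R S : Type) [Ring R] [Algebra Qbar R] [Ring S] [Algebra Qbar S],
      IsNoetherianRing R → IsNoetherianRing S → Nonempty (NCSpec R ≃o NCSpec S) →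
        (DixmierMoeglin Qbar R ↔ DixmierMoeglin Qbar S)) ∧
    -- nor by the topological space of primes
    (¬ ∀ (R S : Type) [Ring R] [Algebra Qbar R] [Ring S] [Algebra Qbar S],
      IsNoetherianRing R → IsNoetherianRing S → Nonempty (NCSpec R ≃ₜ NCSpec S) →
        (DixmierMoeglin Qbar R ↔ DixmierMoeglin Qbar S)) ∧
    -- nor does a finite stratification of the spectrum by spectra of affine commutative algebras
    -- imply it
    (¬ ∀ (R : Type) [Ring R] [Algebra Qbar R],
      Algebra.FiniteType Qbar R → IsNoetherianRing R →
      (∃ (d : ℕ) (X : Fin d → Set (NCSpec R)),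
        (∀ i, IsLocallyClosed (X i)) ∧ Pairwise (fun i j => Disjoint (X i) (X j)) ∧
        (⋃ i, X i) = Set.univ ∧
        ∀ i, ∃ (T : Type) (_ : CommRing T) (_ : Algebra Qbar T),
          Algebra.FiniteType Qbar T ∧ Nonempty (X i ≃ₜ PrimeSpectrum T)) →
      DixmierMoeglin Qbar R) := by

  obtain ⟨e⟩ := nonempty_homeomorph_polynomial
  have e' : NCSpec SkewExample ≃ₜ PrimeSpectrum (Polynomial Qbar) :=
    e.trans NCSpec.homeomorphPrimeSpectrum
  have hpoly : DixmierMoeglin Qbar (Polynomial Qbar) := dixmierMoeglin_polynomial Qbar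
  have hS := not_dixmierMoeglin_skewExample
  have hft : Algebra.FiniteType Qbar SkewExample := SkewLaurent.finiteType sigma
  refine ⟨⟨hft, SkewLaurent.not_finite sigma, isPrimeTwoSided_bot, inferInstance, inferInstance⟩,
    ⟨e'⟩, ⟨skewBot, rfl, isRational_of_eq_bot rfl, not_locallyClosed_skewBot⟩, hS,
    fun h => ?_, fun h => ?_, fun h => ?_⟩
  · exact hS ((h SkewExample (Polynomial Qbar) inferInstance inferInstance
      ⟨NCSpec.orderIsoOfHomeomorph e⟩).2 hpoly)
  · exact hS ((h SkewExample (Polynomial Qbar) inferInstance inferInstance ⟨e⟩).2 hpoly)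
  · refine hS (h SkewExample hft inferInstance ⟨1, fun _ => Set.univ,
      fun _ => isOpen_univ.isLocallyClosed, Subsingleton.pairwise, Set.iUnion_const _, fun _ =>
      ⟨Polynomial Qbar, inferInstance, inferInstance, inferInstance,
        ⟨(Homeomorph.Set.univ _).trans e'⟩⟩⟩)
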